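/- Let $K$ be a finite field, let $S=K[t_1,\ldots,t_s]$ have the standard grading and the graded reverse lexicographic order $\prec$ ($t^a\succ t^b$ if $\deg t^a>\deg t^b$, or $\deg t^a=\deg t^b$ and the last non-zero entry of $a-b$ is negative), and let $\mathbb{X}=\{[P_1],\ldots,[P_m]\}$ be a set of $m\ge 2$ distinct points of $\mathbb{P}^{s-1}$ over $K$, with representatives satisfying $t_s(P_i)=1$ for all $i$. Let $I\subset S$ be the vanishing ideal of $\mathbb{X}$, generated by the homogeneous polynomials that vanish at all points of $\mathbb{X}$, and let $\mathfrak{p}_i$ be the vanishing ideal of $[P_i]$. Let $b_{i,j}$ be the graded Betti numbers of the minimal graded free resolution of $S/I$, so that $F_i=\bigoplus_j S(-j)^{b_{i,j}}$, let ${\rm reg}(S/I)=\max\{j-i\mid b_{i,j}\neq 0\}$, and let $g$ be the projective dimension of $S/I$. Suppose that $I$ is Gorenstein, that is, there is a unique $j$ with $b_{g,j}\neq 0$, and $b_{g,j}=1$ for this $j$. Let $\Delta_\prec(I)$ be the set of standard monomials (the monomials not in the initial ideal ${\rm in}_\prec(I)$), $\Delta_\prec(I)_d$ the set of those of degree $d$,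 and write $K\Gamma$ for the $K$-span of a set $\Gamma$ of monomials. The remainder on division of $f\in S$ by $I$ is the unique $r\in K\Delta_\prec(I)$ with $f-r\in I$. The $i$-th standard indicator function $f_i$ is the homogeneous polynomial in $K\Delta_\prec(I)$, unique up to a non-zero scalar, of degree ${\rm v}_{\mathfrak{p}_i}(I)=\min\{d\ge 0\mid (I\colon f)=\mathfrak{p}_i\text{ for some }f\in S_d\}$ with $f_i(P_i)\neq 0$ and $f_i(P_j)=0$ for $j\neq i$. A standard monomial is essential if it appears in each of $f_1,\ldots,f_m$. Let ${\rm ev}_d\colon S_d\to K^m$ be the map $f\mapsto(f(P_1),\ldots,f(P_m))$, let $C^\perp$ be the dual of $C\subset K^m$ with respect to the ordinary inner product, and let $\gamma\cdot C=\{(\gamma_1c_1,\ldots,\gamma_mc_m)\mid c\in C\}$. Then there is a unique essential monomial $t^a$ such that $t_s$ does not divide $t^a$. Moreover, for all $d,k\ge 0$ and all $\Gamma_1\subset\Delta_\prec(I)_d$, $\Gamma_2\subset\Delta_\prec(I)_k$ satisfying 1. $d+k\le{\rm reg}(S/I)$, 2. $|\Gamma_1|+|\Gamma_2|=|\mathbb{X}|$,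 3. $t^a$ does not appear in the remainder on division of $u_1u_2$ by $I$ for every $u_1\in\Gamma_1$, $u_2\in\Gamma_2$, one has $$\gamma\cdot{\rm ev}_d(K\Gamma_1)={\rm ev}_k(K\Gamma_2)^\perp,$$ where $\gamma=(\beta_1f_1(P_1)^{-1},\ldots,\beta_mf_m(P_m)^{-1})$ and $\beta_i$ is the coefficient of $t^a$ in $f_i$. -/

import Mathlib

open MvPolynomial

namespace ProjEval

/-! ### Minimal graded free resolutions, regularity, Gorenstein ideals -/

/-- A minimal graded free resolution
`0 → F_g → ⋯ → F_1 → F_0 = S → S/I → 0` of `S/I`, where `S = K[t_σ]` has the standard grading.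
The module `F_i` is `⨁_a S(-shift i a)`, with `a` running over `Fin (rank i)`, and the map
`F_{i+1} → F_i` is given by the matrix `d i`. -/
structure MinGradedFreeResolution {σ K : Type*} [Field K] (I : Ideal (MvPolynomial σ K)) where
  /-- the rank of `F_i` -/
  rank : ℕ → ℕ
  /-- the degrees of the basis elements of `F_i` -/
  shift : (i : ℕ) → Fin (rank i) → ℕ
  /-- the differential `F_{i+1} → F_i` -/
  d : (i : ℕ) → Matrix (Fin (rank i)) (Fin (rank (i + 1))) (MvPolynomial σ K)
  /-- `F_0` has rank one -/
  rank_zero : rank 0 = 1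
  /-- the generator of `F_0 = S` has degree zero -/
  shift_zero : ∀ a, shift 0 a = 0
  /-- the resolution has finite length -/
  finite : ∃ N, ∀ i, N < i → rank i = 0
  /-- the differentials are homogeneous of degree zero -/
  graded : ∀ i a b, d i a b ≠ 0 →
    ∃ e, e + shift i a = shift (i + 1) b ∧ (d i a b).IsHomogeneous e
  /-- the image of `F_1` in `F_0 = S` is `I` -/
  range_zero : ∀ x : Fin (rank 0) → MvPolynomial σ K,
    x ∈ LinearMap.range (d 0).mulVecLin ↔ ∀ a, x a ∈ I
  /-- exactness at `F_{i+1}` -/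
  exact : ∀ i, LinearMap.ker (d i).mulVecLin = LinearMap.range (d (i + 1)).mulVecLin
  /-- minimality: all matrix entries lie in the ideal generated by the variables -/
  minimal : ∀ i a b, constantCoeff (d i a b) = 0

/-- The graded Betti number `b_{i,j}`: the number of copies of `S(-j)` in `F_i`. -/
def MinGradedFreeResolution.betti {σ K : Type*} [Field K] {I : Ideal (MvPolynomial σ K)}
    (F : MinGradedFreeResolution I) (i j : ℕ) : ℕ :=
  (Finset.univ.filter fun a : Fin (F.rank i) => F.shift i a = j).card

/-- `g` is the length of the resolution, that is, the projective dimension of `S/I`. -/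
def MinGradedFreeResolution.HasLength {σ K : Type*} [Field K] {I : Ideal (MvPolynomial σ K)}
    (F : MinGradedFreeResolution I) (g : ℕ) : Prop :=
  IsGreatest {i | F.rank i ≠ 0} g

/-- The Castelnuovo–Mumford regularity `reg(S/I) = max {j - i | b_{i,j} ≠ 0}`, where the `b_{i,j}`
are the graded Betti numbers of the minimal graded free resolution of `S/I` (which is unique up to
isomorphism). -/
noncomputable def reg {σ K : Type*} [Field K] (I : Ideal (MvPolynomial σ K)) : ℤ :=
  sSup {n : ℤ | ∃ (F : MinGradedFreeResolution I) (i j : ℕ),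
    F.betti i j ≠ 0 ∧ n = (j : ℤ) - (i : ℤ)}

/-- `I` is Gorenstein: with `g` the projective dimension of `S/I`, there is a unique `j` such that
`b_{g,j} ≠ 0`, and `b_{g,j} = 1`. -/
def IsGorenstein {σ K : Type*} [Field K] (I : Ideal (MvPolynomial σ K)) : Prop :=
  ∃ (F : MinGradedFreeResolution I) (g : ℕ), F.HasLength g ∧
    ∃ j, F.betti g j = 1 ∧ ∀ j', j' ≠ j → F.betti g j' = 0

/-! ### The graded reverse lexicographic order, standard monomials, remainders -/

/-- `GRevLexLT a b` means `t^a ≺ t^b` in the graded reverse lexicographic order: the degree of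
`t^a` is smaller, or the degrees agree and the last non-zero entry of `b - a` is negative. -/
def GRevLexLT {n : ℕ} (a b : Fin n →₀ ℕ) : Prop :=
  a.degree < b.degree ∨
    (a.degree = b.degree ∧ ∃ j, b j < a j ∧ ∀ i, j < i → a i = b i)

/-- `t^a` is the initial monomial of the (non-zero) polynomial `f`. -/
def IsInitialMonomial {n : ℕ} {K : Type*} [Field K] (f : MvPolynomial (Fin n) K)
    (a : Fin n →₀ ℕ) : Prop :=
  a ∈ f.support ∧ ∀ b ∈ f.support, b ≠ a → GRevLexLT b a

/-- The initial ideal of `I`. -/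
noncomputable def initialIdeal {n : ℕ} {K : Type*} [Field K] (I : Ideal (MvPolynomial (Fin n) K)) :
    Ideal (MvPolynomial (Fin n) K) :=
  Ideal.span {u | ∃ f ∈ I, ∃ a, IsInitialMonomial f a ∧ u = monomial a 1}

/-- The footprint `Δ_≺(I)`: the exponents of the monomials outside the initial ideal. -/
def footprint {n : ℕ} {K : Type*} [Field K] (I : Ideal (MvPolynomial (Fin n) K)) :
    Set (Fin n →₀ ℕ) :=
  {a | monomial a (1 : K) ∉ initialIdeal I}

/-- The standard monomials of degree `d`. -/
def footprintDeg {n : ℕ} {K : Type*} [Field K] (I : Ideal (MvPolynomial (Fin n) K)) (d : ℕ) :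
    Set (Fin n →₀ ℕ) :=
  {a | a ∈ footprint I ∧ a.degree = d}

/-- `r` is the remainder on division of `f` by `I`: `r ∈ KΔ_≺(I)` and `f = g + r` with `g ∈ I`.
Here `restrictSupport K Δ` is the `K`-span of the monomials with exponent in `Δ`. -/
def IsRemainder {n : ℕ} {K : Type*} [Field K] (I : Ideal (MvPolynomial (Fin n) K))
    (f r : MvPolynomial (Fin n) K) : Prop :=
  r ∈ restrictSupport K (footprint I) ∧ ∃ g ∈ I, f = g + r

/-! ### Vanishing ideals, v-numbers, indicator functions -/

/-- The graded vanishing ideal of the set of projective points `[P i]`: it is generated by the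
homogeneous polynomials that vanish at all of the points. -/
noncomputable def vanishingIdeal {n : ℕ} {K ι : Type*} [Field K] (P : ι → Fin n → K) :
    Ideal (MvPolynomial (Fin n) K) :=
  Ideal.span {f | (∃ d, f.IsHomogeneous d) ∧ ∀ i, eval (P i) f = 0}

/-- The vanishing ideal of the single projective point `[p]`. -/
noncomputable def pointIdeal {n : ℕ} {K : Type*} [Field K] (p : Fin n → K) : Ideal (MvPolynomial (Fin n) K) :=
  vanishingIdeal fun _ : Unit => p

/-- The local v-number `min {d | ∃ f ∈ S_d, (I : f) = 𝔭_i}` of `I = I(𝕏)` at the vanishing ideal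
`𝔭_i` of `[P i]`. -/
noncomputable def vNumber {n : ℕ} {K ι : Type*} [Field K] (P : ι → Fin n → K) (i : ι) : ℕ :=
  sInf {d | ∃ f : MvPolynomial (Fin n) K,
    f.IsHomogeneous d ∧ (vanishingIdeal P).colon {f} = pointIdeal (P i)}

/-- `f` is an `i`-th standard indicator function (these differ only by non-zero scalars): it is
homogeneous of degree `v_{𝔭_i}(I)`, it is non-zero at `[P i]`, it vanishes at the other points, and
it is a linear combination of standard monomials. -/
def IsStandardIndicator {n : ℕ} {K ι : Type*} [Field K] (P : ι → Fin n → K) (i : ι)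
    (f : MvPolynomial (Fin n) K) : Prop :=
  f.IsHomogeneous (vNumber P i) ∧ eval (P i) f ≠ 0 ∧ (∀ j, j ≠ i → eval (P j) f = 0) ∧
    f ∈ restrictSupport K (footprint (vanishingIdeal P))

/-- The standard monomial `t^a` is essential: it appears in each standard indicator function. -/
def IsEssential {n : ℕ} {K ι : Type*} [Field K] (P : ι → Fin n → K) (a : Fin n →₀ ℕ) : Prop :=
  a ∈ footprint (vanishingIdeal P) ∧ ∀ i f, IsStandardIndicator P i f → coeff a f ≠ 0

/-! ### Evaluation codes -/

/-- The evaluation map `f ↦ (f(P_1), …, f(P_m))`; its restriction to `S_d` is `ev_d`. -/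
noncomputable def ev {n m : ℕ} {K : Type*} [Field K] (P : Fin m → Fin n → K) :
    MvPolynomial (Fin n) K →ₗ[K] (Fin m → K) :=
  LinearMap.pi fun i => (aeval (P i)).toLinearMap

/-- The code `ev_d(KΓ)` for a set `Γ` of (exponents of) monomials of degree `d`. -/
noncomputable def evCode {n m : ℕ} {K : Type*} [Field K] (P : Fin m → Fin n → K)
    (Γ : Finset (Fin n →₀ ℕ)) : Submodule K (Fin m → K) :=
  (restrictSupport K (Γ : Set (Fin n →₀ ℕ))).map (ev P)

/-- The dual code `C^⊥` with respect to the ordinary inner product of `K^m`. -/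
def dualCode {m : ℕ} {K : Type*} [Field K] (C : Submodule K (Fin m → K)) :
    Submodule K (Fin m → K) where
  carrier := {x | ∀ y ∈ C, x ⬝ᵥ y = 0}
  zero_mem' := fun y _ => zero_dotProduct y
  add_mem' := fun {x x'} hx hx' y hy => by rw [add_dotProduct, hx y hy, hx' y hy, add_zero]
  smul_mem' := fun c x hx y hy => by rw [smul_dotProduct, hx y hy, smul_zero]

/-- The code `γ · C = {(γ_1 c_1, …, γ_m c_m) | c ∈ C}`. -/
def scaleCode {m : ℕ} {K : Type*} [Field K] (γ : Fin m → K) (C : Submodule K (Fin m → K)) :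
    Submodule K (Fin m → K) :=
  C.map (LinearMap.mulLeft K γ)

end ProjEval

/-! Write `t` for the last variable and `n + 1` for the number of variables. As `t` is `1` at every
point, it is a nonzerodivisor modulo `I`, and everything is decided in `A = S/(I, t)`. An indicator
`f_i` of minimal degree gives a nonzero socle element of `A`: `X j * f_i` and `P i j * t * f_i`
agree at all points, while `f_i ≡ t * g` modulo `I` would give an indicator of smaller degree.

The socle of `A` embeds into `Tor_n(S/I, K)`, of dimension `F.rank n`, which is one when `I` is
Gorenstein. Hence all v-numbers equal one `v`. By interpolation every form of degree above `v` lies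
in `(I, t)`, so forms of degree `v` are socle elements. For the reverse lexicographic order,
standard monomials prime to `t` are independent modulo `(I, t)` (`eq_zero_of_mem_sectionIdeal`), so
at most one of degree `v` exists. Each `f_i` contains one, being outside `(t)`; this is `t^a`.

For a form `h` of degree `e ≤ v`, the interpolation `t^(v-e) * h ≡ ∑ h(P_i) f_i(P_i)⁻¹ f_i` becomes
an equality once `h` is replaced by its remainder on the left, because multiplication by `t`
preserves standard monomials. Comparing coefficients of `t^a` with `h = u₁u₂` gives orthogonality
(`sum_coeff_mul_eval_eq_zero`); equality of codes follows by counting dimensions. The bound `reg ≤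
v` comes from vanishing of `Tor` in high internal degrees. -/

namespace ProjEval

/-! ### Ideals generated by variables -/

section Variables

variable {n : ℕ} {K : Type*} [Field K]

/-- The ideal generated by the last variable and the first `k` variables. -/
noncomputable def varIdeal (n : ℕ) (K : Type*) [Field K] (k : ℕ) :
    Ideal (MvPolynomial (Fin (n + 1)) K) :=
  Ideal.span (X '' {v | v = Fin.last n ∨ v.val < k})

lemma mem_varIdeal {k : ℕ} {p : MvPolynomial (Fin (n + 1)) K} :
    p ∈ varIdeal n K k ↔ ∀ c ∈ p.support, ∃ v, (v = Fin.last n ∨ v.val < k) ∧ c v ≠ 0 := by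
  simp [varIdeal, mem_ideal_span_X_image]

lemma X_mem_varIdeal {k : ℕ} {v : Fin (n + 1)} (hv : v = Fin.last n ∨ v.val < k) :
    (X v : MvPolynomial (Fin (n + 1)) K) ∈ varIdeal n K k :=
  Ideal.subset_span ⟨v, hv, rfl⟩

lemma varIdeal_mono {k l : ℕ} (h : k ≤ l) : varIdeal n K k ≤ varIdeal n K l :=
  Ideal.span_mono (Set.image_mono fun _ hv => hv.imp id fun h' => h'.trans_le h)

lemma varIdeal_zero : varIdeal n K 0 = Ideal.span {X (Fin.last n)} := by
  simp [varIdeal]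

/-- As `k < n`, this variable is not a generator of `varIdeal n K k`, so it is a nonzerodivisor
modulo that monomial ideal. -/
lemma mem_varIdeal_of_X_mul_mem {k : ℕ} (hk : k < n) {p : MvPolynomial (Fin (n + 1)) K}
    (h : X ⟨k, by omega⟩ * p ∈ varIdeal n K k) : p ∈ varIdeal n K k := by
  rw [mem_varIdeal] at h ⊢
  intro c hc
  obtain ⟨v, hv, hcv⟩ := h (Finsupp.single ⟨k, by omega⟩ 1 + c) (by
    rw [mem_support_iff, coeff_X_mul]
    exact mem_support_iff.1 hc)
  refine ⟨v, hv, ?_⟩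
  have : (⟨k, by omega⟩ : Fin (n + 1)) ≠ v := by
    rintro rfl
    rcases hv with hv | hv
    · simp [Fin.ext_iff] at hv
      omega
    · simp at hv
  simpa [Finsupp.single_apply, this] using hcv

/-- The clause on supports makes the quotient `w` inherit degree bounds from `p`, lowered by one. -/
lemma exists_add_X_mul_of_mem_varIdeal_succ {k : ℕ} (hk : k < n)
    {p : MvPolynomial (Fin (n + 1)) K} (h : p ∈ varIdeal n K (k + 1)) :
    ∃ w, p - X ⟨k, by omega⟩ * w ∈ varIdeal n K k ∧
      ∀ c ∈ w.support, Finsupp.single ⟨k, by omega⟩ 1 + c ∈ p.support := by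
  set x : Fin (n + 1) := ⟨k, by omega⟩
  refine ⟨p.divMonomial (Finsupp.single x 1), ?_, ?_⟩
  · have : p - X x * p.divMonomial (Finsupp.single x 1) = p.modMonomial (Finsupp.single x 1) :=
      sub_eq_of_eq_add' (divMonomial_add_modMonomial_single p x).symm
    rw [this, mem_varIdeal]
    intro c hc
    have hle : ¬ Finsupp.single x 1 ≤ c := fun hle => by
      rw [mem_support_iff, coeff_modMonomial_of_le _ hle] at hc
      exact hc rfl
    rw [mem_support_iff, coeff_modMonomial_of_not_le _ hle] at hc
    obtain ⟨v, hv, hcv⟩ := mem_varIdeal.1 h c (mem_support_iff.2 hc)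
    refine ⟨v, hv.imp id fun hv' => ?_, hcv⟩
    have : v ≠ x := by
      rintro rfl
      exact hle (by simpa [Finsupp.single_le_iff] using Nat.one_le_iff_ne_zero.2 hcv)
    have : v.val ≠ k := fun h => this (Fin.ext h)
    omega
  · intro c hc
    rwa [mem_support_iff, coeff_divMonomial, ← mem_support_iff] at hc

lemma constantCoeff_eq_zero_of_mem_varIdeal {k : ℕ} {p : MvPolynomial (Fin (n + 1)) K}
    (h : p ∈ varIdeal n K k) : constantCoeff p = 0 := by
  by_contra h0
  obtain ⟨v, -, hv⟩ := mem_varIdeal.1 h 0 (mem_support_iff.2 h0)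
  exact hv rfl

lemma mem_varIdeal_of_constantCoeff_eq_zero {p : MvPolynomial (Fin (n + 1)) K}
    (h : constantCoeff p = 0) : p ∈ varIdeal n K n := by
  rw [mem_varIdeal]
  intro c hc
  have hc0 : c ≠ 0 := by
    rintro rfl
    exact mem_support_iff.1 hc h
  obtain ⟨v, hv⟩ := Finsupp.ne_iff.1 hc0
  refine ⟨v, ?_, hv⟩
  rcases eq_or_ne v (Fin.last n) with h | h
  · exact Or.inl h
  · exact Or.inr (Fin.val_lt_last h)

end Variables

/-! ### Koszul induction for `Tor(S/I, S/J)`, `J` generated by variables -/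

namespace MinGradedFreeResolution

variable {n : ℕ} {K : Type*} [Field K] {I : Ideal (MvPolynomial (Fin (n + 1)) K)}
  (F : MinGradedFreeResolution I)

/-- The degrees of the terms of `z ∈ F_i`, all of them satisfying `p`. -/
def HasWeights {i : ℕ} (p : ℕ → Prop) (z : Fin (F.rank i) → MvPolynomial (Fin (n + 1)) K) : Prop :=
  ∀ a, ∀ c ∈ (z a).support, p (c.degree + F.shift i a)

variable {F}

lemma HasWeights.sub {i : ℕ} {p : ℕ → Prop} {z w : Fin (F.rank i) → MvPolynomial (Fin (n + 1)) K}
    (hz : F.HasWeights p z) (hw : F.HasWeights p w) : F.HasWeights p (z - w) := by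
  classical
  intro a c hc
  rcases Finset.mem_union.1 (support_sub _ _ _ hc) with h | h
  exacts [hz a c h, hw a c h]

lemma HasWeights.mulVec {i : ℕ} {p : ℕ → Prop}
    {z : Fin (F.rank (i + 1)) → MvPolynomial (Fin (n + 1)) K}
    (hz : F.HasWeights p z) : F.HasWeights p ((F.d i).mulVec z) := by
  classical
  intro b c hc
  obtain ⟨a, -, ha⟩ := Finset.mem_biUnion.1 (support_sum hc)
  obtain ⟨c₁, h₁, c₂, h₂, rfl⟩ := Finset.mem_add.1 (support_mul _ _ ha)
  obtain ⟨e, he, hom⟩ := F.graded i b a (by rintro h; simp [h] at h₁)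
  have hd : c₁.degree = e := hom.degree_eq_sum_deg_support h₁ |>.symm
  have := hz a c₂ h₂
  rw [map_add, hd]
  convert! this using 1
  omega

/-- The terms of `z` of degree greater than `D`. -/
lemma exists_hasWeights_split {i : ℕ} (z : Fin (F.rank i) → MvPolynomial (Fin (n + 1)) K) (D : ℕ) :
    ∃ y, F.HasWeights (D < ·) y ∧ F.HasWeights (· ≤ D) (z - y) := by
  classical
  have h1 : ∀ a c, coeff c (∑ c' ∈ (z a).support.filter (fun c => D < c.degree + F.shift i a),
      monomial c' (coeff c' (z a))) =
      if D < c.degree + F.shift i a then coeff c (z a) else 0 := by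
    intro a c
    rw [coeff_sum]
    simp only [coeff_monomial, Finset.sum_ite_eq', Finset.mem_filter, mem_support_iff]
    split_ifs <;> simp_all
  refine ⟨fun a => ∑ c ∈ (z a).support.filter (fun c => D < c.degree + F.shift i a),
    monomial c (coeff c (z a)), fun a c hc => ?_, fun a c hc => ?_⟩
  · rw [mem_support_iff, h1] at hc
    by_contra h
    simp [h] at hc
  · rw [mem_support_iff, Pi.sub_apply, coeff_sub, h1] at hc
    by_contra h
    simp [not_le.1 h] at hc

variable (F)

/-- `z ∈ F_i` is a cycle modulo `J`. -/
def IsCycleMod (J : Ideal (MvPolynomial (Fin (n + 1)) K)) :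
    (i : ℕ) → (Fin (F.rank i) → MvPolynomial (Fin (n + 1)) K) → Prop
  | 0, _ => True
  | i + 1, z => ∀ a, (F.d i).mulVec z a ∈ J

/-- `z ∈ F_i` is a boundary modulo `J`. -/
def IsBoundaryMod (J : Ideal (MvPolynomial (Fin (n + 1)) K)) (i : ℕ)
    (z : Fin (F.rank i) → MvPolynomial (Fin (n + 1)) K) : Prop :=
  ∃ c, ∀ a, (z - (F.d i).mulVec c) a ∈ J

variable {F}

lemma mulVec_mem {J : Ideal (MvPolynomial (Fin (n + 1)) K)} {i : ℕ}
    {z : Fin (F.rank (i + 1)) → MvPolynomial (Fin (n + 1)) K} (h : ∀ a, z a ∈ J) (b) :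
    (F.d i).mulVec z b ∈ J := by
  rw [Matrix.mulVec, dotProduct]
  exact sum_mem fun a _ => J.mul_mem_left _ (h a)

lemma mulVec_mulVec (i : ℕ) (z : Fin (F.rank (i + 2)) → MvPolynomial (Fin (n + 1)) K) :
    (F.d i).mulVec ((F.d (i + 1)).mulVec z) = 0 := by
  have : (F.d (i + 1)).mulVec z ∈ LinearMap.ker (F.d i).mulVecLin := by
    rw [F.exact i]
    exact ⟨z, rfl⟩
  exact this

lemma exists_mulVec_eq {i : ℕ} {z : Fin (F.rank (i + 1)) → MvPolynomial (Fin (n + 1)) K}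
    (h : (F.d i).mulVec z = 0) : ∃ c, (F.d (i + 1)).mulVec c = z := by
  have : z ∈ LinearMap.ker (F.d i).mulVecLin := h
  rw [F.exact i] at this
  exact this

/-- Dropping the terms of `c` of weight at most `D` changes its boundary only in weights at most
`D`, and membership in a monomial ideal is tested term by term. -/
lemma IsBoundaryMod.exists_hasWeights {k i D : ℕ}
    {z : Fin (F.rank i) → MvPolynomial (Fin (n + 1)) K}
    (h : F.IsBoundaryMod (varIdeal n K k) i z) (hz : F.HasWeights (D < ·) z) :
    ∃ c, F.HasWeights (D < ·) c ∧ ∀ a, (z - (F.d i).mulVec c) a ∈ varIdeal n K k := by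
  obtain ⟨c, hc⟩ := h
  obtain ⟨y, hy, hcy⟩ := F.exists_hasWeights_split c D
  refine ⟨y, hy, fun a => ?_⟩
  have h1 := hz.sub hy.mulVec
  have h2 := hcy.mulVec
  rw [mem_varIdeal]
  intro e he
  refine mem_varIdeal.1 (hc a) e ?_
  have h3 : z - (F.d i).mulVec c = (z - (F.d i).mulVec y) - (F.d i).mulVec (c - y) := by
    rw [Matrix.mulVec_sub]
    abel
  have h4 := h1 a e he
  have h5 : coeff e ((F.d i).mulVec (c - y) a) = 0 := by
    by_contra h6
    exact absurd (h2 a e (mem_support_iff.2 h6)) (not_le.2 h4)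
  rw [h3, mem_support_iff, Pi.sub_apply, coeff_sub, h5, sub_zero]
  exact mem_support_iff.1 he

/-- If `dz = t * w`, then `w` is a boundary `dc`: for `i = 0` because `t` is a nonzerodivisor modulo
`I`, otherwise because `t * dw = 0`. So `z - t * c` is a cycle, hence a boundary. -/
lemma isBoundaryMod_zero {i : ℕ} (hI : ∀ p, X (Fin.last n) * p ∈ I → p ∈ I)
    {z : Fin (F.rank (i + 1)) → MvPolynomial (Fin (n + 1)) K}
    (hz : F.IsCycleMod (varIdeal n K 0) (i + 1) z) :
    F.IsBoundaryMod (varIdeal n K 0) (i + 1) z := by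
  have h1 : ∀ a, ∃ w, (F.d i).mulVec z a = X (Fin.last n) * w := fun a => by
    have := hz a
    rwa [varIdeal_zero, Ideal.mem_span_singleton] at this
  choose w hw using h1
  have hw' : (F.d i).mulVec z = (X (Fin.last n) : MvPolynomial (Fin (n + 1)) K) • w := funext hw
  obtain ⟨c, hc⟩ : ∃ c, (F.d i).mulVec c = w := by
    cases i with
    | zero =>
      refine (F.range_zero w).2 fun a => hI _ ?_
      rw [← hw]
      exact (F.range_zero _).1 ⟨z, rfl⟩ a
    | succ i =>
      apply exists_mulVec_eq
      have := mulVec_mulVec i z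
      rw [hw', Matrix.mulVec_smul] at this
      exact (smul_eq_zero.1 this).resolve_left (X_ne_zero _)
  obtain ⟨c', hc'⟩ := exists_mulVec_eq
    (z := z - (X (Fin.last n) : MvPolynomial (Fin (n + 1)) K) • c) (by
      rw [Matrix.mulVec_sub, Matrix.mulVec_smul, hc, hw', sub_self])
  refine ⟨c', fun a => ?_⟩
  rw [hc', sub_sub_cancel]
  exact Ideal.mul_mem_right _ _ (X_mem_varIdeal (Or.inl rfl))

/-- `Tor_i(S/I, S/J) = 0` in high homological or internal degrees, for `J` generated by
variables. -/
theorem isBoundaryMod_of_isCycleMod (hI : ∀ p, X (Fin.last n) * p ∈ I → p ∈ I) {r : ℕ}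
    (hr : ∀ p : MvPolynomial (Fin (n + 1)) K, (∀ c ∈ p.support, r < c.degree) →
      ∃ q ∈ I, p - q ∈ varIdeal n K 0) {k : ℕ} (hk : k ≤ n) :
    ∀ (i : ℕ) (z : Fin (F.rank i) → MvPolynomial (Fin (n + 1)) K),
      (k < i ∨ F.HasWeights (r + i < ·) z) → F.IsCycleMod (varIdeal n K k) i z →
      F.IsBoundaryMod (varIdeal n K k) i z := by
  induction k with
  | zero =>
    intro i z hz hc
    cases i with
    | zero =>
      have hz := hz.resolve_left (lt_irrefl 0)
      have h1 : ∀ a, ∃ q ∈ I, z a - q ∈ varIdeal n K 0 := fun a => hr _ fun c hc => by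
        simpa [F.shift_zero] using hz a c hc
      choose q hq hq' using h1
      obtain ⟨c, hc⟩ := (F.range_zero q).2 hq
      exact ⟨c, fun a => by
        have : (F.d 0).mulVec c = q := hc
        rw [this]
        exact hq' a⟩
    | succ i => exact isBoundaryMod_zero hI hc
  | succ k ih =>
    have ih := ih (by omega)
    have hkn : k < n := by omega
    set x : MvPolynomial (Fin (n + 1)) K := X ⟨k, by omega⟩ with hx
    have hxk : x ∈ varIdeal n K (k + 1) := X_mem_varIdeal (Or.inr (by simp))
    intro i z hz hc
    cases i with
    | zero =>
      obtain ⟨c, hc⟩ := ih 0 z (Or.inr (hz.resolve_left (by omega))) trivial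
      exact ⟨c, fun a => varIdeal_mono (by omega) (hc a)⟩
    | succ i =>
      -- The connecting map for multiplication by `x` on `S/J_k`, where `J_k = varIdeal n K k`: `dz
      -- = x * w` modulo `J_k`, and `w` is a cycle one step lower in both homological and internal
      -- degree.
      choose w hw hws using fun a => exists_add_X_mul_of_mem_varIdeal_succ hkn (hc a)
      have hww : k < i ∨ F.HasWeights (r + i < ·) w := by
        refine hz.imp (by omega) fun hz a c hc => ?_
        have := hz.mulVec a _ (hws a c hc)
        simp at this
        omega
      have hu : ∀ a, ((F.d i).mulVec z - x • w) a ∈ varIdeal n K k := hw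
      have hwc : F.IsCycleMod (varIdeal n K k) i w := by
        cases i with
        | zero => trivial
        | succ i =>
          intro a
          apply mem_varIdeal_of_X_mul_mem hkn
          have := mulVec_mem hu a
          rw [Matrix.mulVec_sub, mulVec_mulVec, zero_sub, Matrix.mulVec_smul, Pi.neg_apply,
            neg_mem_iff] at this
          exact this
      have hwb := ih i w hww hwc
      obtain ⟨w', hw', hwd⟩ : ∃ w', (k < i ∨ F.HasWeights (r + i < ·) w') ∧
          ∀ a, (w - (F.d i).mulVec w') a ∈ varIdeal n K k := by
        rcases hww with h | h
        · obtain ⟨c, hc⟩ := hwb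
          exact ⟨c, Or.inl h, hc⟩
        · obtain ⟨c, hc, hc'⟩ := hwb.exists_hasWeights h
          exact ⟨c, Or.inr hc, hc'⟩
      -- With `w = dw'` modulo `J_k`, the correction `z - x * w'` is a cycle modulo `J_k` and agrees
      -- with `z` modulo `J_(k+1)`.
      have hcyc : F.IsCycleMod (varIdeal n K k) (i + 1) (z - x • w') := by
        intro a
        have : (F.d i).mulVec (z - x • w') =
            ((F.d i).mulVec z - x • w) + x • (w - (F.d i).mulVec w') := by
          rw [Matrix.mulVec_sub, Matrix.mulVec_smul, smul_sub]
          abel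
        rw [this]
        exact add_mem (hu a) (Ideal.mul_mem_left _ _ (hwd a))
      obtain ⟨c, hc⟩ := ih (i + 1) (z - x • w') (by
        rcases hz with hz | hz
        · exact Or.inl (by omega)
        · rcases hw' with hw' | hw'
          · exact Or.inl (by omega)
          · refine Or.inr (hz.sub fun a e he => ?_)
            rw [Pi.smul_apply, smul_eq_mul, hx, support_X_mul] at he
            obtain ⟨e', he', rfl⟩ := Finset.mem_map.1 he
            have := hw' a e' he'
            simp
            omega) hcyc
      refine ⟨c, fun a => ?_⟩
      have : z - (F.d (i + 1)).mulVec c = (z - x • w' - (F.d (i + 1)).mulVec c) + x • w' := by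
        abel
      rw [this]
      exact add_mem (varIdeal_mono (by omega) (hc a)) (Ideal.mul_mem_right _ _ hxk)

lemma constantCoeff_mulVec (i : ℕ) (z : Fin (F.rank (i + 1)) → MvPolynomial (Fin (n + 1)) K) (b) :
    constantCoeff ((F.d i).mulVec z b) = 0 := by
  simp [Matrix.mulVec, dotProduct, F.minimal]

/-- Minimality makes all differentials zero modulo the maximal ideal `varIdeal n K n`, so basis
vectors of `F_i` survive in `Tor_i(S/I, K)`; vanishing of `Tor` then excludes them. -/
lemma not_isBoundaryMod_single (i : ℕ) (a : Fin (F.rank i)) :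
    ¬ F.IsBoundaryMod (varIdeal n K n) i (Pi.single a 1) := by
  rintro ⟨c, hc⟩
  have := constantCoeff_eq_zero_of_mem_varIdeal (hc a)
  simp [constantCoeff_mulVec] at this

lemma isCycleMod_varIdeal (i : ℕ) (z : Fin (F.rank i) → MvPolynomial (Fin (n + 1)) K) :
    F.IsCycleMod (varIdeal n K n) i z := by
  cases i with
  | zero => trivial
  | succ i => exact fun a => mem_varIdeal_of_constantCoeff_eq_zero (constantCoeff_mulVec i z a)

theorem rank_eq_zero (hI : ∀ p, X (Fin.last n) * p ∈ I → p ∈ I) {r : ℕ}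
    (hr : ∀ p : MvPolynomial (Fin (n + 1)) K, (∀ c ∈ p.support, r < c.degree) →
      ∃ q ∈ I, p - q ∈ varIdeal n K 0) {i : ℕ} (hi : n < i) : F.rank i = 0 := by
  by_contra h
  exact not_isBoundaryMod_single i ⟨0, Nat.pos_of_ne_zero h⟩
    (isBoundaryMod_of_isCycleMod hI hr le_rfl i _ (Or.inl hi) (isCycleMod_varIdeal i _))

theorem shift_le (hI : ∀ p, X (Fin.last n) * p ∈ I → p ∈ I) {r : ℕ}
    (hr : ∀ p : MvPolynomial (Fin (n + 1)) K, (∀ c ∈ p.support, r < c.degree) →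
      ∃ q ∈ I, p - q ∈ varIdeal n K 0) (i : ℕ) (a : Fin (F.rank i)) : F.shift i a ≤ r + i := by
  by_contra h
  refine not_isBoundaryMod_single i a
    (isBoundaryMod_of_isCycleMod hI hr le_rfl i _ (Or.inr fun b c hc => ?_) (isCycleMod_varIdeal i _))
  rcases eq_or_ne b a with rfl | hb
  · simp only [Pi.single_eq_same] at hc
    omega
  · simp [Pi.single_eq_of_ne hb] at hc

/-- The socle of `S/(I, t)` embeds into `Tor_n(S/I, K)`, for `t` the last variable. -/
theorem exists_sum_mem_of_socle (hI : ∀ p, X (Fin.last n) * p ∈ I → p ∈ I) {r : ℕ}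
    (hr : ∀ p : MvPolynomial (Fin (n + 1)) K, (∀ c ∈ p.support, r < c.degree) →
      ∃ q ∈ I, p - q ∈ varIdeal n K 0) {ι : Type*} [Fintype ι]
    (hι : F.rank n < Fintype.card ι) {k : ℕ} (hk : k ≤ n)
    (f : ι → Fin (F.rank k) → MvPolynomial (Fin (n + 1)) K)
    (hf : ∀ i j, F.IsBoundaryMod (varIdeal n K k) k ((X j : MvPolynomial (Fin (n + 1)) K) • f i)) :
    ∃ c : ι → K, c ≠ 0 ∧ F.IsBoundaryMod (varIdeal n K k) k (∑ i, c i • f i) := by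
  induction hk using Nat.decreasingInduction with
  | self =>
    -- For `k = n`, only the vectors of constant terms matter, and there are more of them than
    -- `F.rank n`.
    have hdep : ¬ LinearIndependent K fun i => fun a => constantCoeff (f i a) := fun h => by
      have := h.fintype_card_le_finrank
      simp at this
      omega
    obtain ⟨c, hc, i, hi⟩ := Fintype.not_linearIndependent_iff.1 hdep
    refine ⟨c, fun h => hi (congrFun h i), 0, fun a => ?_⟩
    apply mem_varIdeal_of_constantCoeff_eq_zero
    have := congrFun hc a
    simpa [MvPolynomial.smul_eq_C_mul] using this
  | of_succ k hk ih =>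
    have hkn : k < n := hk
    set x : MvPolynomial (Fin (n + 1)) K := X ⟨k, by omega⟩ with hx
    have hxk : x ∈ varIdeal n K (k + 1) := X_mem_varIdeal (Or.inr (by simp))
    -- `x * f_i = d b_i` modulo `J_k`. The `b_i` are again killed by all variables, modulo
    -- boundaries and `J_(k+1)`, because `Tor_(k+1)(S/I, S/J_k) = 0`.
    choose b hb using fun i => hf i ⟨k, by omega⟩
    obtain ⟨c, hc, e, he⟩ := ih b (fun i j => by
      obtain ⟨y, hy⟩ := hf i j
      obtain ⟨y', hy'⟩ := isBoundaryMod_of_isCycleMod hI hr hkn.le (k + 1)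
        ((X j : MvPolynomial (Fin (n + 1)) K) • b i - x • y) (Or.inl (by omega)) (fun a => by
          have : (F.d k).mulVec ((X j : MvPolynomial (Fin (n + 1)) K) • b i - x • y) =
              x • ((X j : MvPolynomial (Fin (n + 1)) K) • f i - (F.d k).mulVec y) -
              (X j : MvPolynomial (Fin (n + 1)) K) • (x • f i - (F.d k).mulVec (b i)) := by
            rw [Matrix.mulVec_sub, Matrix.mulVec_smul, Matrix.mulVec_smul, smul_sub, smul_sub,
              smul_comm x]
            abel
          rw [this]
          exact sub_mem (Ideal.mul_mem_left _ _ (hy a)) (Ideal.mul_mem_left _ _ (hb i a)))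
      refine ⟨y', fun a => ?_⟩
      have : (X j : MvPolynomial (Fin (n + 1)) K) • b i - (F.d (k + 1)).mulVec y' =
          ((X j : MvPolynomial (Fin (n + 1)) K) • b i - x • y - (F.d (k + 1)).mulVec y') + x • y := by abel
      rw [this]
      exact add_mem (varIdeal_mono (by omega) (hy' a)) (Ideal.mul_mem_right _ _ hxk))
    refine ⟨c, hc, ?_⟩
    choose y hy _ using fun a => exists_add_X_mul_of_mem_varIdeal_succ hkn (he a)
    have hy : ∀ a, (∑ i, c i • b i - (F.d (k + 1)).mulVec e - x • y) a ∈ varIdeal n K k := hy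
    -- Injectivity: applying `d` to `∑ c_i b_i ≡ de + x * y` gives `x * ∑ c_i f_i ≡ x * dy` modulo
    -- `J_k`, and `x` cancels.
    refine ⟨y, fun a => mem_varIdeal_of_X_mul_mem hkn ?_⟩
    have h1 : x • (∑ i, c i • f i - (F.d k).mulVec y) =
        ∑ i, c i • (x • f i - (F.d k).mulVec (b i)) +
          (F.d k).mulVec (∑ i, c i • b i - (F.d (k + 1)).mulVec e - x • y) := by
      rw [Matrix.mulVec_sub, Matrix.mulVec_sub, mulVec_mulVec, Matrix.mulVec_smul,
        Matrix.mulVec_sum]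
      simp only [Matrix.mulVec_smul, smul_sub, Finset.sum_sub_distrib, Finset.smul_sum, sub_zero,
        smul_comm x]
      abel
    have h2 : (x • (∑ i, c i • f i - (F.d k).mulVec y)) a ∈ varIdeal n K k := by
      rw [h1, Pi.add_apply, Finset.sum_apply]
      refine add_mem (sum_mem fun i _ => ?_) (mulVec_mem hy a)
      rw [Pi.smul_apply, MvPolynomial.smul_eq_C_mul]
      exact Ideal.mul_mem_left _ _ (hb i a)
    exact h2

end MinGradedFreeResolution

end ProjEval

namespace ProjEval

/-! ### The graded vanishing ideal -/

section VanishingIdeal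

variable {n : ℕ} {K ι : Type*} [Field K] {P : ι → Fin n → K}

lemma eval_eq_zero_of_mem_vanishingIdeal {f : MvPolynomial (Fin n) K}
    (hf : f ∈ vanishingIdeal P) (i : ι) : eval (P i) f = 0 := by
  have : vanishingIdeal P ≤ RingHom.ker (eval (P i)) := Ideal.span_le.2 fun g hg => hg.2 i
  exact this hf

lemma homogeneousComponent_mem_vanishingIdeal {f : MvPolynomial (Fin n) K}
    (hf : f ∈ vanishingIdeal P) (d : ℕ) : homogeneousComponent d f ∈ vanishingIdeal P := by
  let _ : GradedAlgebra (homogeneousSubmodule (Fin n) K) := MvPolynomial.gradedAlgebra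
  exact homogeneousComponent_mem_of_mem (Ideal.homogeneous_span _ _ fun g hg => hg.1) hf d

lemma mem_vanishingIdeal_of_isHomogeneous {f : MvPolynomial (Fin n) K} {d : ℕ}
    (hf : f.IsHomogeneous d) (h : ∀ i, eval (P i) f = 0) : f ∈ vanishingIdeal P :=
  Ideal.subset_span ⟨⟨d, hf⟩, h⟩

lemma mem_of_homogeneousComponent_mem {I : Ideal (MvPolynomial (Fin n) K)}
    {f : MvPolynomial (Fin n) K} (h : ∀ d, homogeneousComponent d f ∈ I) : f ∈ I := by
  rw [← sum_homogeneousComponent f]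
  exact sum_mem fun d _ => h d

/-- The ideal is homogeneous, so every component must vanish; vanishing of `f` itself at the
representatives would not suffice. -/
lemma mem_vanishingIdeal_iff {f : MvPolynomial (Fin n) K} :
    f ∈ vanishingIdeal P ↔ ∀ d i, eval (P i) (homogeneousComponent d f) = 0 :=
  ⟨fun h d i => eval_eq_zero_of_mem_vanishingIdeal (homogeneousComponent_mem_vanishingIdeal h d) i,
    fun h => mem_of_homogeneousComponent_mem fun d =>
      mem_vanishingIdeal_of_isHomogeneous (homogeneousComponent_isHomogeneous d f) (h d)⟩

lemma homogeneousComponent_mul_of_isHomogeneous {f : MvPolynomial (Fin n) K} {e : ℕ}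
    (hf : f.IsHomogeneous e) (d : ℕ) (g : MvPolynomial (Fin n) K) :
    homogeneousComponent (d + e) (g * f) = homogeneousComponent d g * f := by
  have h1 : ∀ k, homogeneousComponent (d + e) (homogeneousComponent k g * f) =
      if k = d then homogeneousComponent d g * f else 0 := fun k => by
    rw [homogeneousComponent_of_mem ((homogeneousComponent_isHomogeneous k g).mul hf)]
    simp only [add_left_inj, eq_comm]
    split_ifs with h
    · rw [h]
    · rfl
  conv_lhs => rw [← sum_homogeneousComponent g, Finset.sum_mul, map_sum]
  simp only [h1, Finset.sum_ite_eq', Finset.mem_range]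
  split_ifs with h
  · rfl
  · rw [homogeneousComponent_eq_zero _ _ (by omega), zero_mul]

lemma mem_vanishingIdeal_of_mul_mem {f g : MvPolynomial (Fin n) K} {e : ℕ}
    (hf : f.IsHomogeneous e) (h0 : ∀ i, eval (P i) f ≠ 0) (h : g * f ∈ vanishingIdeal P) :
    g ∈ vanishingIdeal P := by
  rw [mem_vanishingIdeal_iff] at h ⊢
  intro d i
  have := h (d + e) i
  rw [homogeneousComponent_mul_of_isHomogeneous hf, map_mul] at this
  exact (mul_eq_zero.1 this).resolve_right (h0 i)

/-- `f` is a form of degree `d` that vanishes at all the points except at `[P i]`. -/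
def IsIndicator (P : ι → Fin n → K) (i : ι) (d : ℕ) (f : MvPolynomial (Fin n) K) : Prop :=
  f.IsHomogeneous d ∧ eval (P i) f ≠ 0 ∧ ∀ j, j ≠ i → eval (P j) f = 0

lemma mem_pointIdeal_iff {p : Fin n → K} {f : MvPolynomial (Fin n) K} :
    f ∈ pointIdeal p ↔ ∀ d, eval p (homogeneousComponent d f) = 0 := by
  simp [pointIdeal, mem_vanishingIdeal_iff]

end VanishingIdeal

/-! ### Indicator functions and v-numbers -/

section Indicator

variable {n : ℕ} {K ι : Type*} [Field K] {P : ι → Fin (n + 1) → K}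

lemma exists_linear_separating (hinj : Function.Injective P)
    (hlast : ∀ i, P i (Fin.last n) = 1) {i j : ι} (hij : i ≠ j) :
    ∃ L : MvPolynomial (Fin (n + 1)) K, L.IsHomogeneous 1 ∧ eval (P i) L ≠ 0 ∧
      eval (P j) L = 0 := by
  obtain ⟨l, hl⟩ := Function.ne_iff.1 (hinj.ne hij)
  refine ⟨X l - C (P j l) * X (Fin.last n),
    (isHomogeneous_X _ _).sub (isHomogeneous_C_mul_X _ _), ?_, ?_⟩
  · simpa [hlast, sub_eq_zero] using hl
  · simp [hlast]

/-- A linear form vanishing at `P i` but not at `P j` multiplies `f` into `I`, which forces `f(P j)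
= 0`. If `f(P i)` were also zero, the colon ideal would contain `1`. -/
lemma colon_eq_pointIdeal_iff (hinj : Function.Injective P)
    (hlast : ∀ i, P i (Fin.last n) = 1) {i : ι} {d : ℕ} {f : MvPolynomial (Fin (n + 1)) K}
    (hf : f.IsHomogeneous d) :
    (vanishingIdeal P).colon {f} = pointIdeal (P i) ↔ IsIndicator P i d f := by
  constructor
  · intro h
    have hj : ∀ j, j ≠ i → eval (P j) f = 0 := fun j hj => by
      obtain ⟨L, hL, hLj, hLi⟩ := exists_linear_separating hinj hlast hj
      have hmem : L ∈ (vanishingIdeal P).colon {f} := by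
        rw [h]
        exact mem_vanishingIdeal_of_isHomogeneous hL fun _ => hLi
      rw [Submodule.mem_colon_singleton, smul_eq_mul] at hmem
      have := eval_eq_zero_of_mem_vanishingIdeal hmem j
      rw [map_mul] at this
      exact (mul_eq_zero.1 this).resolve_left hLj
    refine ⟨hf, fun h0 => ?_, hj⟩
    have h1 : (1 : MvPolynomial (Fin (n + 1)) K) ∈ (vanishingIdeal P).colon {f} := by
      rw [Submodule.mem_colon_singleton, one_smul]
      refine mem_vanishingIdeal_of_isHomogeneous hf fun j => ?_
      rcases eq_or_ne j i with rfl | hji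
      exacts [h0, hj j hji]
    rw [h] at h1
    simpa using eval_eq_zero_of_mem_vanishingIdeal h1 ()
  · rintro ⟨-, hi, hj⟩
    ext g
    rw [Submodule.mem_colon_singleton, smul_eq_mul, mem_pointIdeal_iff]
    constructor
    · intro h e
      have := mem_vanishingIdeal_iff.1 h (e + d) i
      rw [homogeneousComponent_mul_of_isHomogeneous hf, map_mul] at this
      exact (mul_eq_zero.1 this).resolve_right hi
    · intro h
      rw [← sum_homogeneousComponent g, Finset.sum_mul]
      refine sum_mem fun e _ => mem_vanishingIdeal_of_isHomogeneous
        ((homogeneousComponent_isHomogeneous e g).mul hf) fun j => ?_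
      rw [map_mul]
      rcases eq_or_ne j i with rfl | hji
      · rw [h, zero_mul]
      · rw [hj j hji, mul_zero]

lemma exists_isIndicator [Fintype ι] (hinj : Function.Injective P)
    (hlast : ∀ i, P i (Fin.last n) = 1) (i : ι) : ∃ d f, IsIndicator P i d f := by
  classical
  have h : ∀ j, ∃ L : MvPolynomial (Fin (n + 1)) K, j ≠ i → L.IsHomogeneous 1 ∧
      eval (P i) L ≠ 0 ∧ eval (P j) L = 0 := fun j => by
    by_cases hj : j = i
    · exact ⟨0, fun h => absurd hj h⟩
    · obtain ⟨L, hL⟩ := exists_linear_separating hinj hlast (Ne.symm hj)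
      exact ⟨L, fun _ => hL⟩
  choose L hL using h
  refine ⟨_, ∏ j ∈ Finset.univ.erase i, L j,
    IsHomogeneous.prod _ _ (fun _ => 1) fun j hj => (hL j (Finset.ne_of_mem_erase hj)).1, ?_, ?_⟩
  · rw [map_prod]
    exact Finset.prod_ne_zero_iff.2 fun j hj => (hL j (Finset.ne_of_mem_erase hj)).2.1
  · intro j hj
    rw [map_prod]
    exact Finset.prod_eq_zero (Finset.mem_erase.2 ⟨hj, Finset.mem_univ j⟩) (hL j hj).2.2

lemma vNumber_eq_sInf (hinj : Function.Injective P) (hlast : ∀ i, P i (Fin.last n) = 1) (i : ι) :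
    vNumber P i = sInf {d | ∃ f, IsIndicator P i d f} := by
  unfold vNumber
  congr 1
  ext d
  refine exists_congr fun f => ⟨fun h => (colon_eq_pointIdeal_iff hinj hlast h.1).1 h.2,
    fun h => ⟨h.1, (colon_eq_pointIdeal_iff hinj hlast h.1).2 h⟩⟩

lemma exists_isIndicator_vNumber [Fintype ι] (hinj : Function.Injective P)
    (hlast : ∀ i, P i (Fin.last n) = 1) (i : ι) : ∃ f, IsIndicator P i (vNumber P i) f := by
  rw [vNumber_eq_sInf hinj hlast]
  exact Nat.sInf_mem (s := {d | ∃ f, IsIndicator P i d f}) (exists_isIndicator hinj hlast i)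

lemma IsIndicator.vNumber_le (hinj : Function.Injective P)
    (hlast : ∀ i, P i (Fin.last n) = 1) {i : ι} {d : ℕ} {f : MvPolynomial (Fin (n + 1)) K}
    (hf : IsIndicator P i d f) : vNumber P i ≤ d := by
  rw [vNumber_eq_sInf hinj hlast]
  exact Nat.sInf_le ⟨f, hf⟩

end Indicator

/-! ### The quotient by `(I, t)`, its socle, and the Gorenstein condition -/

section Section

variable {n : ℕ} {K ι : Type*} [Field K] {P : ι → Fin (n + 1) → K}

/-- The ideal `(I, t)`, where `t` is the last variable. -/
noncomputable def sectionIdeal (P : ι → Fin (n + 1) → K) : Ideal (MvPolynomial (Fin (n + 1)) K) :=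
  vanishingIdeal P ⊔ Ideal.span {X (Fin.last n)}

lemma mem_sectionIdeal {p : MvPolynomial (Fin (n + 1)) K} :
    p ∈ sectionIdeal P ↔ ∃ h, p - X (Fin.last n) * h ∈ vanishingIdeal P := by
  rw [sectionIdeal, Submodule.mem_sup]
  constructor
  · rintro ⟨g, hg, y, hy, rfl⟩
    obtain ⟨h, rfl⟩ := Ideal.mem_span_singleton.1 hy
    exact ⟨h, by simpa using hg⟩
  · rintro ⟨h, hh⟩
    exact ⟨_, hh, _, Ideal.mem_span_singleton.2 (dvd_mul_right _ h), by ring⟩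

lemma homogeneousComponent_mem_sectionIdeal {f : MvPolynomial (Fin (n + 1)) K}
    (hf : f ∈ sectionIdeal P) (d : ℕ) : homogeneousComponent d f ∈ sectionIdeal P := by
  let _ : GradedAlgebra (homogeneousSubmodule (Fin (n + 1)) K) := MvPolynomial.gradedAlgebra
  refine homogeneousComponent_mem_of_mem (Ideal.IsHomogeneous.sup
    (Ideal.homogeneous_span _ _ fun g hg => hg.1) (Ideal.homogeneous_span _ _ ?_)) hf d
  rintro _ rfl
  exact ⟨1, isHomogeneous_X _ _⟩

lemma mem_vanishingIdeal_of_X_mul_mem (hlast : ∀ i, P i (Fin.last n) = 1)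
    {p : MvPolynomial (Fin (n + 1)) K} (h : X (Fin.last n) * p ∈ vanishingIdeal P) :
    p ∈ vanishingIdeal P :=
  mem_vanishingIdeal_of_mul_mem (isHomogeneous_X K (Fin.last n)) (by simp [hlast])
    (by rwa [mul_comm])

/-- `X j * f` and `P i j * t * f` have the same values at all points; thus `f` is a socle element
modulo `(I, t)`. -/
lemma IsIndicator.X_mul_mem_sectionIdeal (hlast : ∀ i, P i (Fin.last n) = 1) {i : ι} {d : ℕ}
    {f : MvPolynomial (Fin (n + 1)) K} (hf : IsIndicator P i d f) (j : Fin (n + 1)) :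
    X j * f ∈ sectionIdeal P := by
  refine mem_sectionIdeal.2 ⟨C (P i j) * f, mem_vanishingIdeal_of_isHomogeneous (d := 1 + d)
    (((isHomogeneous_X _ _).mul hf.1).sub ((isHomogeneous_X _ _).mul (hf.1.C_mul _))) fun l => ?_⟩
  rcases eq_or_ne l i with rfl | hl
  · simp [hlast]
  · simp [hf.2.2 l hl]

/-- If `f ≡ t * g` modulo `I`, the component of `g` of degree one less is an indicator, against
minimality; in degree zero `f` would vanish at `P i`. -/
lemma IsIndicator.notMem_sectionIdeal (hinj : Function.Injective P)
    (hlast : ∀ i, P i (Fin.last n) = 1) {i : ι}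
    {f : MvPolynomial (Fin (n + 1)) K} (hf : IsIndicator P i (vNumber P i) f) :
    f ∉ sectionIdeal P := by
  intro h
  obtain ⟨g, hg⟩ := mem_sectionIdeal.1 h
  rcases hv : vNumber P i with _ | v
  · have h1 := mem_vanishingIdeal_iff.1 hg 0 i
    rw [hv] at hf
    rw [map_sub, homogeneousComponent_eq_self hf.1, homogeneousComponent_zero (X _ * g)] at h1
    simp only [coeff_X_mul', Finsupp.support_zero, Finset.notMem_empty, if_false, map_zero,
      sub_zero] at h1
    exact hf.2.1 h1
  · have h1 := mem_vanishingIdeal_iff.1 hg (v + 1)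
    rw [hv] at hf
    rw [map_sub, homogeneousComponent_eq_self hf.1, mul_comm,
      homogeneousComponent_mul_of_isHomogeneous (isHomogeneous_X K (Fin.last n))] at h1
    simp only [map_sub, map_mul, eval_X, hlast, mul_one, sub_eq_zero] at h1
    have : IsIndicator P i v (homogeneousComponent v g) :=
      ⟨homogeneousComponent_isHomogeneous v g, h1 i ▸ hf.2.1, fun j hj => by
        rw [← h1 j, hf.2.2 j hj]⟩
    have := this.vNumber_le hinj hlast
    omega

/-- Lagrange interpolation: powers of `t` equalize the degrees without changing values at the
points. -/
lemma sub_sum_indicator_mem [Fintype ι] (hlast : ∀ i, P i (Fin.last n) = 1) {v : ι → ℕ}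
    {f : ι → MvPolynomial (Fin (n + 1)) K} (hf : ∀ i, IsIndicator P i (v i) (f i)) {d : ℕ}
    (hd : ∀ i, v i ≤ d) {h : MvPolynomial (Fin (n + 1)) K} (hh : h.IsHomogeneous d) :
    h - ∑ i, C (eval (P i) h * (eval (P i) (f i))⁻¹) *
      (X (Fin.last n) ^ (d - v i) * f i) ∈ vanishingIdeal P := by
  classical
  refine mem_vanishingIdeal_of_isHomogeneous (d := d) (hh.sub ?_) fun j => ?_
  · refine IsHomogeneous.sum _ _ _ fun i _ => IsHomogeneous.C_mul ?_ _
    have := (isHomogeneous_X_pow (R := K) (Fin.last n) (d - v i)).mul (hf i).1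
    rwa [Nat.sub_add_cancel (hd i)] at this
  · rw [map_sub, map_sum, Finset.sum_eq_single j]
    · simp [hlast, inv_mul_cancel_right₀ (hf j).2.1]
    · intro i _ hij
      simp [(hf i).2.2 j hij.symm]
    · simp

/-- Above all the degrees `v i`, each term of the interpolation formula is divisible by `t`. -/
lemma mem_sectionIdeal_of_isHomogeneous [Fintype ι] (hlast : ∀ i, P i (Fin.last n) = 1)
    {v : ι → ℕ} {f : ι → MvPolynomial (Fin (n + 1)) K} (hf : ∀ i, IsIndicator P i (v i) (f i))
    {d : ℕ} (hd : ∀ i, v i < d) {h : MvPolynomial (Fin (n + 1)) K} (hh : h.IsHomogeneous d) :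
    h ∈ sectionIdeal P := by
  have h1 := sub_sum_indicator_mem hlast hf (fun i => (hd i).le) hh
  have h2 : ∑ i, C (eval (P i) h * (eval (P i) (f i))⁻¹) *
      (X (Fin.last n) ^ (d - v i) * f i) ∈ sectionIdeal P := by
    refine sum_mem fun i _ => Ideal.mul_mem_left _ _ (Ideal.mul_mem_right _ _ ?_)
    exact Ideal.pow_mem_of_mem _ (Ideal.mem_sup_right (Ideal.mem_span_singleton_self _)) _
      (Nat.sub_pos_of_lt (hd i))
  simpa [sectionIdeal] using add_mem (Ideal.mem_sup_left h1 : _ ∈ sectionIdeal P) h2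

lemma exists_sub_mem_varIdeal [Fintype ι] (hlast : ∀ i, P i (Fin.last n) = 1)
    {v : ι → ℕ} {f : ι → MvPolynomial (Fin (n + 1)) K} (hf : ∀ i, IsIndicator P i (v i) (f i))
    {r : ℕ} (hr : ∀ i, v i ≤ r) (p : MvPolynomial (Fin (n + 1)) K)
    (hp : ∀ c ∈ p.support, r < c.degree) :
    ∃ q ∈ vanishingIdeal P, p - q ∈ varIdeal n K 0 := by
  have h : p ∈ sectionIdeal P := mem_of_homogeneousComponent_mem fun d => by
    rcases lt_or_ge r d with hd | hd
    · exact mem_sectionIdeal_of_isHomogeneous hlast hf (fun i => (hr i).trans_lt hd)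
        (homogeneousComponent_isHomogeneous d p)
    · rw [homogeneousComponent_eq_zero' _ _ fun c hc => by have := hp c hc; omega]
      exact zero_mem _
  obtain ⟨g, hg⟩ := mem_sectionIdeal.1 h
  refine ⟨_, hg, ?_⟩
  rw [sub_sub_cancel, varIdeal_zero]
  exact Ideal.mul_mem_right _ _ (Ideal.mem_span_singleton_self _)

/-- Since `F_0 = S`, this identifies `Tor_0(S/I, S/(t))` with `S/(I, t)`. -/
lemma isBoundaryMod_const_iff (F : MinGradedFreeResolution (vanishingIdeal P))
    (p : MvPolynomial (Fin (n + 1)) K) :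
    F.IsBoundaryMod (varIdeal n K 0) 0 (fun _ => p) ↔ p ∈ sectionIdeal P := by
  constructor
  · rintro ⟨c, hc⟩
    let a : Fin (F.rank 0) := ⟨0, by rw [F.rank_zero]; exact one_pos⟩
    have h1 : (F.d 0).mulVec c a ∈ vanishingIdeal P := (F.range_zero _).1 ⟨c, rfl⟩ a
    have h2 := hc a
    rw [varIdeal_zero] at h2
    simpa [sectionIdeal] using add_mem (Ideal.mem_sup_right h2 : _ ∈ sectionIdeal P) (Ideal.mem_sup_left h1)
  · intro h
    obtain ⟨g, hg⟩ := mem_sectionIdeal.1 h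
    obtain ⟨c, hc⟩ := (F.range_zero fun _ => p - X (Fin.last n) * g).2 fun _ => hg
    refine ⟨c, fun a => ?_⟩
    have hc : (F.d 0).mulVec c = fun _ => p - X (Fin.last n) * g := hc
    rw [hc, Pi.sub_apply, sub_sub_cancel, varIdeal_zero]
    exact Ideal.mul_mem_right _ _ (Ideal.mem_span_singleton_self _)

lemma exists_sum_mem_sectionIdeal [Fintype ι] (hinj : Function.Injective P)
    (hlast : ∀ i, P i (Fin.last n) = 1) (F : MinGradedFreeResolution (vanishingIdeal P))
    {κ : Type*} [Fintype κ] (hκ : F.rank n < Fintype.card κ)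
    (g : κ → MvPolynomial (Fin (n + 1)) K) (hg : ∀ i j, X j * g i ∈ sectionIdeal P) :
    ∃ c : κ → K, c ≠ 0 ∧ ∑ i, c i • g i ∈ sectionIdeal P := by
  choose f hf using exists_isIndicator_vNumber hinj hlast
  obtain ⟨c, hc, h⟩ := MinGradedFreeResolution.exists_sum_mem_of_socle (F := F)
    (fun _ => mem_vanishingIdeal_of_X_mul_mem hlast)
    (exists_sub_mem_varIdeal hlast hf fun i => Finset.le_sup (Finset.mem_univ i)) hκ
    (Nat.zero_le n) (fun i _ => g i) fun i j => (isBoundaryMod_const_iff F _).2 (hg i j)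
  refine ⟨c, hc, (isBoundaryMod_const_iff F _).1 ?_⟩
  convert! h using 1
  ext1 a
  simp

/-- If `I` is Gorenstein, then `S/(I, t)` has a socle of dimension one. -/
theorem exists_smul_add_smul_mem [Fintype ι] [Nonempty ι] (hinj : Function.Injective P)
    (hlast : ∀ i, P i (Fin.last n) = 1) (hG : IsGorenstein (vanishingIdeal P))
    {f g : MvPolynomial (Fin (n + 1)) K} (hf : ∀ j, X j * f ∈ sectionIdeal P)
    (hg : ∀ j, X j * g ∈ sectionIdeal P) :
    ∃ a b : K, (a ≠ 0 ∨ b ≠ 0) ∧ a • f + b • g ∈ sectionIdeal P := by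
  obtain ⟨F, l, ⟨hl, hmax⟩, j, hj, hj'⟩ := hG
  have hrank : F.rank n = 1 := by
    choose f hf using exists_isIndicator_vNumber hinj hlast
    -- An indicator is a nonzero socle element, so `Tor_n` cannot vanish. The resolution therefore
    -- has length exactly `n`, and its last module has rank one.
    have h0 : F.rank n ≠ 0 := fun h0 => by
      obtain ⟨i⟩ := ‹Nonempty ι›
      obtain ⟨c, hc, hmem⟩ := exists_sum_mem_sectionIdeal hinj hlast F (κ := Unit)
        (by simp [h0]) (fun _ => f i) fun _ j => (hf i).X_mul_mem_sectionIdeal hlast j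
      have hc' : c () ≠ 0 := fun h => hc (funext fun _ => h)
      refine (hf i).notMem_sectionIdeal hinj hlast ?_
      have := Ideal.mul_mem_left _ (C (c ())⁻¹) hmem
      simpa [smul_eq_C_mul, ← mul_assoc, ← C_mul, inv_mul_cancel₀ hc'] using this
    have hln : l = n := by
      refine le_antisymm (not_lt.1 fun hlt => hl ?_) (hmax h0)
      exact MinGradedFreeResolution.rank_eq_zero (fun _ => mem_vanishingIdeal_of_X_mul_mem hlast)
        (exists_sub_mem_varIdeal hlast hf fun i => Finset.le_sup (Finset.mem_univ i)) hlt
    rw [hln] at hj hj'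
    refine Eq.trans ?_ hj
    rw [MinGradedFreeResolution.betti, Finset.filter_true_of_mem, Finset.card_univ,
      Fintype.card_fin]
    intro a _
    by_contra ha
    have := hj' _ ha
    rw [MinGradedFreeResolution.betti, Finset.card_eq_zero, Finset.filter_eq_empty_iff] at this
    exact this (Finset.mem_univ a) rfl
  obtain ⟨c, hc, h⟩ := exists_sum_mem_sectionIdeal hinj hlast F (κ := Fin 2) (by simp [hrank])
    ![f, g] (by simpa [Fin.forall_fin_two] using ⟨hf, hg⟩)
  refine ⟨c 0, c 1, ?_, by simpa using h⟩
  by_contra! h0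
  exact hc (funext fun i => by fin_cases i <;> simp [h0])

/-- Two indicators are dependent modulo the homogeneous ideal `(I, t)`. In different degrees the
relation would split and put one of them in the ideal. -/
theorem vNumber_eq_vNumber [Fintype ι] (hinj : Function.Injective P)
    (hlast : ∀ i, P i (Fin.last n) = 1) (hG : IsGorenstein (vanishingIdeal P)) (i j : ι) :
    vNumber P i = vNumber P j := by
  have : Nonempty ι := ⟨i⟩
  choose f hf using exists_isIndicator_vNumber hinj hlast
  by_contra hne
  obtain ⟨a, b, hab, h⟩ := exists_smul_add_smul_mem hinj hlast hG
    ((hf i).X_mul_mem_sectionIdeal hlast) ((hf j).X_mul_mem_sectionIdeal hlast)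
  have key : ∀ (a : K) (i : ι), a • f i ∈ sectionIdeal P → a = 0 := fun a i h => by
    by_contra ha
    refine (hf i).notMem_sectionIdeal hinj hlast ?_
    have := Ideal.mul_mem_left _ (C a⁻¹) h
    simpa [smul_eq_C_mul, ← mul_assoc, ← C_mul, inv_mul_cancel₀ ha] using this
  have h1 := homogeneousComponent_mem_sectionIdeal h (vNumber P i)
  have h2 := homogeneousComponent_mem_sectionIdeal h (vNumber P j)
  rw [map_add, map_smul, map_smul, homogeneousComponent_of_mem (hf i).1,
    homogeneousComponent_of_mem (hf j).1] at h1 h2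
  simp only [if_true, if_neg hne, if_neg (Ne.symm hne), smul_zero, add_zero, zero_add] at h1 h2
  exact hab.elim (· (key _ _ h1)) (· (key _ _ h2))

theorem reg_le [Fintype ι] (hinj : Function.Injective P) (hlast : ∀ i, P i (Fin.last n) = 1)
    {v : ℕ} (hv : ∀ i, vNumber P i = v) : reg (vanishingIdeal P) ≤ v := by
  choose f hf using exists_isIndicator_vNumber hinj hlast
  have h : ∀ x ∈ {l : ℤ | ∃ (F : MinGradedFreeResolution (vanishingIdeal P)) (i j : ℕ),
      F.betti i j ≠ 0 ∧ l = (j : ℤ) - (i : ℤ)}, x ≤ v := by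
    rintro _ ⟨F, i, j, hb, rfl⟩
    obtain ⟨a, ha⟩ := Finset.card_ne_zero.1 hb
    have := MinGradedFreeResolution.shift_le (F := F)
      (fun _ => mem_vanishingIdeal_of_X_mul_mem hlast)
      (exists_sub_mem_varIdeal hlast hf fun i => (hv i).le) i a
    rw [(Finset.mem_filter.1 ha).2] at this
    omega
  unfold reg
  rcases Set.eq_empty_or_nonempty {l : ℤ | ∃ (F : MinGradedFreeResolution (vanishingIdeal P))
      (i j : ℕ), F.betti i j ≠ 0 ∧ l = (j : ℤ) - (i : ℤ)} with h0 | h0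
  -- The supremum of an empty set of integers is `0` by convention.
  · rw [h0, Int.csSup_empty]
    positivity
  · exact csSup_le h0 h

end Section

end ProjEval

namespace ProjEval

/-! ### The graded reverse lexicographic order -/

section Order

variable {n : ℕ}

instance : IsStrictOrder (Fin n →₀ ℕ) GRevLexLT where
  irrefl a h := by
    rcases h with h | ⟨-, j, h, -⟩
    exacts [lt_irrefl _ h, lt_irrefl _ h]
  trans a b c := by
    rintro (h | ⟨h, j, hj, hj'⟩) (h' | ⟨h', k, hk, hk'⟩)
    · exact Or.inl (h.trans h')
    · exact Or.inl (h' ▸ h)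
    · exact Or.inl (h ▸ h')
    · refine Or.inr ⟨h.trans h', ?_⟩
      rcases lt_trichotomy j k with hjk | rfl | hjk
      · exact ⟨k, by rwa [hj' k hjk], fun i hi => (hj' i (hjk.trans hi)).trans (hk' i hi)⟩
      · exact ⟨j, hk.trans hj, fun i hi => (hj' i hi).trans (hk' i hi)⟩
      · exact ⟨j, by rwa [← hk' j hjk], fun i hi => (hj' i hi).trans (hk' i (hjk.trans hi))⟩

lemma gRevLexLT_total {a b : Fin n →₀ ℕ} (h : a ≠ b) : GRevLexLT a b ∨ GRevLexLT b a := by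
  rcases lt_trichotomy a.degree b.degree with hd | hd | hd
  · exact Or.inl (Or.inl hd)
  · obtain ⟨l, hl⟩ := Finsupp.ne_iff.1 h
    have hne : (Finset.univ.filter fun i => a i ≠ b i).Nonempty := ⟨l, by simpa using hl⟩
    obtain ⟨j, hj, hmax⟩ := Finset.exists_max_image _ id hne
    have heq : ∀ i, j < i → a i = b i := fun i hi => by
      by_contra hi'
      exact absurd (hmax i (by simpa using hi')) (not_le.2 hi)
    rcases lt_or_gt_of_ne (Finset.mem_filter.1 hj).2 with h' | h'
    · exact Or.inr (Or.inr ⟨hd.symm, j, h', fun i hi => (heq i hi).symm⟩)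
    · exact Or.inl (Or.inr ⟨hd, j, h', heq⟩)
  · exact Or.inr (Or.inl hd)

lemma GRevLexLT.degree_le {a b : Fin n →₀ ℕ} (h : GRevLexLT a b) : a.degree ≤ b.degree :=
  h.elim le_of_lt fun h => h.1.le

lemma GRevLexLT.add_left {a b : Fin n →₀ ℕ} (h : GRevLexLT a b) (c : Fin n →₀ ℕ) :
    GRevLexLT (c + a) (c + b) := by
  rcases h with h | ⟨h, j, hj, hj'⟩
  · exact Or.inl (by simpa using h)
  · exact Or.inr ⟨by simpa using h, j, by simpa using hj, fun i hi => by simpa using hj' i hi⟩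

/-- Only finitely many monomials have degree at most that of `b`, so the order is well founded below
`b`. -/
lemma gRevLexLT_induction {p : (Fin n →₀ ℕ) → Prop}
    (h : ∀ b, (∀ a, GRevLexLT a b → p a) → p b) (b : Fin n →₀ ℕ) : p b := by
  have hwf := (Finsupp.finite_of_degree_le (σ := Fin n) b.degree).wellFoundedOn (r := GRevLexLT)
  refine hwf.induction (P := p) (le_refl b.degree) fun y hy ih => h y fun a ha => ih a ?_ ha
  exact ha.degree_le.trans hy

end Order

/-! ### Standard monomials and division -/

section Footprint

variable {n : ℕ} {K : Type*} [Field K] {I : Ideal (MvPolynomial (Fin n) K)}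

lemma exists_isInitialMonomial {f : MvPolynomial (Fin n) K} (hf : f ≠ 0) :
    ∃ a, IsInitialMonomial f a := by
  have h : ∀ s : Finset (Fin n →₀ ℕ), s.Nonempty → ∃ a ∈ s, ∀ b ∈ s, b ≠ a → GRevLexLT b a := by
    intro s hs
    induction hs using Finset.Nonempty.cons_induction with
    | singleton a => exact ⟨a, by simp, by simp⟩
    | cons c s hc hs ih =>
      obtain ⟨a, ha, hmax⟩ := ih
      have hca : c ≠ a := fun h => hc (h ▸ ha)
      rcases gRevLexLT_total hca with h | h
      · refine ⟨a, Finset.mem_cons_of_mem ha, fun b hb hba => ?_⟩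
        rcases Finset.mem_cons.1 hb with rfl | hb
        exacts [h, hmax b hb hba]
      · refine ⟨c, Finset.mem_cons_self c s, fun b hb hbc => ?_⟩
        have hb := (Finset.mem_cons.1 hb).resolve_left hbc
        rcases eq_or_ne b a with rfl | hba
        exacts [h, _root_.trans (hmax b hb hba) h]
  exact h _ (support_nonempty.2 hf)

lemma notMem_footprint_iff {b : Fin n →₀ ℕ} :
    b ∉ footprint I ↔ ∃ f ∈ I, ∃ a, IsInitialMonomial f a ∧ a ≤ b := by
  have h : {u : MvPolynomial (Fin n) K |
      ∃ f ∈ I, ∃ a, IsInitialMonomial f a ∧ u = monomial a 1} =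
      (fun s => monomial s (1 : K)) '' {a | ∃ f ∈ I, IsInitialMonomial f a} := by
    ext u
    constructor
    · rintro ⟨f, hf, a, ha, rfl⟩
      exact ⟨a, ⟨f, hf, ha⟩, rfl⟩
    · rintro ⟨a, ⟨f, hf, ha⟩, rfl⟩
      exact ⟨f, hf, a, ha, rfl⟩
  have hs : (monomial b (1 : K)).support = {b} := Finsupp.support_single b one_ne_zero
  rw [footprint, Set.mem_ofPred_eq, not_not, initialIdeal, h, mem_ideal_span_monomial_image, hs]
  simp only [Finset.mem_singleton, forall_eq, Set.mem_ofPred_eq]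
  exact ⟨fun ⟨a, ⟨f, hf, ha⟩, hab⟩ => ⟨f, hf, a, ha, hab⟩,
    fun ⟨f, hf, a, ha, hab⟩ => ⟨a, ⟨f, hf, ha⟩, hab⟩⟩

lemma eq_zero_of_mem_of_mem_restrictSupport {f : MvPolynomial (Fin n) K} (hf : f ∈ I)
    (hf' : f ∈ restrictSupport K (footprint I)) : f = 0 := by
  by_contra h0
  obtain ⟨a, ha⟩ := exists_isInitialMonomial h0
  exact notMem_footprint_iff.2 ⟨f, hf, a, ha, le_rfl⟩ ((mem_restrictSupport_iff K).1 hf' ha.1)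

/-- Every polynomial has a remainder on division by `I`. -/
theorem exists_isRemainder (I : Ideal (MvPolynomial (Fin n) K)) (f : MvPolynomial (Fin n) K) :
    ∃ r, IsRemainder I f r := by
  let W : Submodule K (MvPolynomial (Fin n) K) :=
    I.restrictScalars K ⊔ restrictSupport K (footprint I)
  have hsum : ∀ q : MvPolynomial (Fin n) K, (∀ c ∈ q.support, monomial c 1 ∈ W) → q ∈ W := by
    intro q hq
    rw [q.as_sum]
    refine sum_mem fun c hc => ?_
    have := W.smul_mem (coeff c q) (hq c hc)
    rwa [smul_monomial, smul_eq_mul, mul_one] at this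
  have hmon : ∀ b, monomial b 1 ∈ W := by
    refine gRevLexLT_induction fun b ih => ?_
    by_cases hb : b ∈ footprint I
    · exact Submodule.mem_sup_right ((monomial_mem_restrictSupport K).2 (Or.inl hb))
    · obtain ⟨g, hg, a, ha, hab⟩ := notMem_footprint_iff.1 hb
      have hc : coeff a g ≠ 0 := mem_support_iff.1 ha.1
      have hp : (coeff a g)⁻¹ • (monomial (b - a) 1 * g) ∈ W :=
        W.smul_mem _ (Submodule.mem_sup_left (I.mul_mem_left _ hg))
      -- Subtracting the normalized multiple of `g` cancels `t^b` and leaves only smaller monomials.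
      have hq : monomial b 1 - (coeff a g)⁻¹ • (monomial (b - a) 1 * g) ∈ W := by
        refine hsum _ fun e he => ih e ?_
        rw [mem_support_iff, coeff_sub, coeff_smul, coeff_monomial, coeff_monomial_mul'] at he
        have hle : b - a ≤ e := by
          by_contra hle
          rcases eq_or_ne b e with rfl | hbe
          · exact hle tsub_le_self
          · simp [hle, hbe] at he
        rw [if_pos hle, one_mul] at he
        have hne : e - (b - a) ≠ a := by
          intro h
          have hbe : b = e := by
            rw [← tsub_add_cancel_of_le hle, h, add_tsub_cancel_of_le hab]
          rw [if_pos hbe, h, smul_eq_mul, inv_mul_cancel₀ hc, sub_self] at he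
          exact he rfl
        have hbe : b ≠ e := by
          rintro rfl
          exact hne (tsub_tsub_cancel_of_le hab)
        rw [if_neg hbe] at he
        have hs : e - (b - a) ∈ g.support := by
          rw [mem_support_iff]
          rintro h
          simp [h] at he
        have := (ha.2 _ hs hne).add_left (b - a)
        rwa [add_tsub_cancel_of_le hle, tsub_add_cancel_of_le hab] at this
      simpa using add_mem hq hp
  obtain ⟨g, hg, r, hr, h⟩ := Submodule.mem_sup.1 (hsum f fun c _ => hmon c)
  exact ⟨r, hr, g, hg, h.symm⟩

lemma homogeneousComponent_mem_restrictSupport {Δ : Set (Fin n →₀ ℕ)}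
    {f : MvPolynomial (Fin n) K} (hf : f ∈ restrictSupport K Δ) (d : ℕ) :
    homogeneousComponent d f ∈ restrictSupport K Δ := by
  rw [mem_restrictSupport_iff] at hf ⊢
  rw [support_homogeneousComponent]
  exact (Finset.coe_subset.2 (Finset.filter_subset _ _)).trans hf

end Footprint

/-! ### Reverse lexicographic order and the last variable -/

section LastVariable

variable {n : ℕ} {K ι : Type*} [Field K] {P : ι → Fin (n + 1) → K}

/-- If an initial monomial `t^a` divides `t * t^b` but not `t^b`, it is divisible by `t`. In this
order `t` then divides the whole top-degree component, and the quotient by `t` lies in `I` with an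
initial monomial dividing `t^b`. -/
lemma add_single_last_mem_footprint (hlast : ∀ i, P i (Fin.last n) = 1) {b : Fin (n + 1) →₀ ℕ}
    (hb : b ∈ footprint (vanishingIdeal P)) :
    b + Finsupp.single (Fin.last n) 1 ∈ footprint (vanishingIdeal P) := by
  by_contra h
  obtain ⟨f, hf, a, ha, hab⟩ := notMem_footprint_iff.1 h
  by_cases hle : a ≤ b
  · exact notMem_footprint_iff.2 ⟨f, hf, a, ha, hle⟩ hb
  have ha0 : a (Fin.last n) ≠ 0 := fun h0 => hle fun i => by
    rcases eq_or_ne i (Fin.last n) with rfl | hi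
    · simp [h0]
    · simpa [Finsupp.single_apply, hi.symm] using hab i
  set g := homogeneousComponent a.degree f with hg
  have hsup : ∀ c ∈ g.support, c ∈ f.support ∧ c.degree = a.degree := fun c hc => by
    rw [hg, support_homogeneousComponent] at hc
    exact Finset.mem_filter.1 hc
  have hag : a ∈ g.support := by
    rw [hg, support_homogeneousComponent]
    exact Finset.mem_filter.2 ⟨ha.1, rfl⟩
  have hdvd : g ∈ Ideal.span (X '' {Fin.last n}) := by
    rw [mem_ideal_span_X_image]
    refine fun c hc => ⟨Fin.last n, rfl, fun hc0 => ?_⟩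
    have hca : c ≠ a := by
      rintro rfl
      exact ha0 hc0
    rcases ha.2 c (hsup c hc).1 hca with h' | ⟨-, j, hj, hj'⟩
    · exact absurd (hsup c hc).2 h'.ne
    · rcases eq_or_ne j (Fin.last n) with rfl | hjl
      · omega
      · exact ha0 ((hj' _ (Fin.lt_last_iff_ne_last.2 hjl)).symm.trans hc0)
  rw [Set.image_singleton, Ideal.mem_span_singleton] at hdvd
  obtain ⟨q, hq⟩ := hdvd
  have hqI : q ∈ vanishingIdeal P := mem_vanishingIdeal_of_X_mul_mem hlast
    (hq ▸ homogeneousComponent_mem_vanishingIdeal hf _)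
  have hq0 : q ≠ 0 := by
    rintro rfl
    rw [hq, mul_zero] at hag
    simp at hag
  obtain ⟨c, hc⟩ := exists_isInitialMonomial hq0
  have hcg : Finsupp.single (Fin.last n) 1 + c ∈ g.support := by
    rw [hq, mem_support_iff, coeff_X_mul]
    exact mem_support_iff.1 hc.1
  have hac : Finsupp.single (Fin.last n) 1 + c = a := by
    by_contra hne
    have h1 := ha.2 _ (hsup _ hcg).1 hne
    rw [hq, support_X_mul] at hag
    obtain ⟨a', ha', haa⟩ := Finset.mem_map.1 hag
    have haa : Finsupp.single (Fin.last n) 1 + a' = a := haa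
    have hca' : a' ≠ c := by
      rintro rfl
      exact hne haa
    have h2 := (hc.2 a' ha' hca').add_left (Finsupp.single (Fin.last n) 1)
    rw [haa] at h2
    exact irrefl _ (_root_.trans h1 h2)
  refine notMem_footprint_iff.2 ⟨q, hqI, c, hc, ?_⟩ hb
  rw [← hac, add_comm b] at hab
  exact le_of_add_le_add_left hab

lemma X_last_pow_mul_mem_restrictSupport (hlast : ∀ i, P i (Fin.last n) = 1)
    {f : MvPolynomial (Fin (n + 1)) K}
    (hf : f ∈ restrictSupport K (footprint (vanishingIdeal P))) (e : ℕ) :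
    X (Fin.last n) ^ e * f ∈ restrictSupport K (footprint (vanishingIdeal P)) := by
  induction e with
  | zero => simpa using hf
  | succ e ih =>
    rw [pow_succ', mul_assoc, mem_restrictSupport_iff, support_X_mul]
    intro c hc
    obtain ⟨b, hb, rfl⟩ := Finset.mem_map.1 hc
    have := add_single_last_mem_footprint hlast ((mem_restrictSupport_iff K).1 ih hb)
    rwa [add_comm b] at this

/-- The standard monomials that are not divisible by the last variable `t` are linearly independent
modulo `(I, t)`. -/
lemma eq_zero_of_mem_sectionIdeal (hlast : ∀ i, P i (Fin.last n) = 1)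
    {f : MvPolynomial (Fin (n + 1)) K} (hf : f ∈ sectionIdeal P)
    (hΔ : f ∈ restrictSupport K (footprint (vanishingIdeal P)))
    (h0 : ∀ c ∈ f.support, c (Fin.last n) = 0) : f = 0 := by
  obtain ⟨g, hg⟩ := mem_sectionIdeal.1 hf
  obtain ⟨r, hr, q, hq, rfl⟩ := exists_isRemainder (vanishingIdeal P) g
  -- Both `f` and `t * r` are standard and congruent modulo `I`, hence equal; so `t` divides every
  -- term of `f`.
  have h1 : f - X (Fin.last n) * r = 0 := by
    refine eq_zero_of_mem_of_mem_restrictSupport (I := vanishingIdeal P) ?_ (sub_mem hΔ ?_)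
    · have := add_mem hg (Ideal.mul_mem_left _ (X (Fin.last n)) hq)
      rwa [mul_add, sub_add_eq_add_sub, add_comm f, add_sub_add_left_eq_sub] at this
    · simpa using X_last_pow_mul_mem_restrictSupport hlast hr 1
  rw [sub_eq_zero] at h1
  by_contra hne
  obtain ⟨c, hc⟩ := support_nonempty.2 hne
  have := h0 c hc
  rw [h1, support_X_mul] at hc
  obtain ⟨b, -, rfl⟩ := Finset.mem_map.1 hc
  simp at this

end LastVariable

end ProjEval

namespace ProjEval

/-! ### Standard indicators and the coefficient of `t^a` -/

section StandardIndicator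

variable {n : ℕ} {K ι : Type*} [Field K] {P : ι → Fin (n + 1) → K}

lemma IsStandardIndicator.isIndicator {i : ι} {f : MvPolynomial (Fin (n + 1)) K}
    (hf : IsStandardIndicator P i f) : IsIndicator P i (vNumber P i) f :=
  ⟨hf.1, hf.2.1, hf.2.2.1⟩

/-- The remainder of an indicator has the same values in the relevant degree. -/
lemma exists_isStandardIndicator [Fintype ι] (hinj : Function.Injective P)
    (hlast : ∀ i, P i (Fin.last n) = 1) (i : ι) : ∃ f, IsStandardIndicator P i f := by
  obtain ⟨f, hf⟩ := exists_isIndicator_vNumber hinj hlast i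
  obtain ⟨r, hr, g, hg, h⟩ := exists_isRemainder (vanishingIdeal P) f
  have h1 : ∀ j, eval (P j) f = eval (P j) (homogeneousComponent (vNumber P i) r) := fun j => by
    have := congrArg (fun q => eval (P j) (homogeneousComponent (vNumber P i) q)) h
    simpa [homogeneousComponent_eq_self hf.1, mem_vanishingIdeal_iff.1 hg] using this
  exact ⟨homogeneousComponent (vNumber P i) r, homogeneousComponent_isHomogeneous _ _,
    h1 i ▸ hf.2.1, fun j hj => h1 j ▸ hf.2.2 j hj, homogeneousComponent_mem_restrictSupport hr _⟩

lemma IsStandardIndicator.exists_mem_support (hinj : Function.Injective P)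
    (hlast : ∀ i, P i (Fin.last n) = 1) {i : ι} {f : MvPolynomial (Fin (n + 1)) K}
    (hf : IsStandardIndicator P i f) : ∃ c ∈ f.support, c (Fin.last n) = 0 := by
  by_contra! h
  refine hf.isIndicator.notMem_sectionIdeal hinj hlast (Ideal.mem_sup_right ?_)
  rw [← Set.image_singleton, mem_ideal_span_X_image]
  exact fun c hc => ⟨_, rfl, h c hc⟩

lemma IsStandardIndicator.mem_footprintDeg {i : ι} {f : MvPolynomial (Fin (n + 1)) K}
    (hf : IsStandardIndicator P i f) {c : Fin (n + 1) →₀ ℕ} (hc : c ∈ f.support) :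
    c ∈ footprintDeg (vanishingIdeal P) (vNumber P i) :=
  ⟨(mem_restrictSupport_iff K).1 hf.2.2.2 hc, (hf.1.degree_eq_sum_deg_support hc).symm⟩

/-- In the Gorenstein case, there is only one standard monomial of the socle degree that is not
divisible by the last variable. -/
lemma eq_of_mem_footprintDeg [Fintype ι] [Nonempty ι] (hinj : Function.Injective P)
    (hlast : ∀ i, P i (Fin.last n) = 1) (hG : IsGorenstein (vanishingIdeal P)) {v : ℕ}
    (hv : ∀ i, vNumber P i = v) {a b : Fin (n + 1) →₀ ℕ}
    (ha : a ∈ footprintDeg (vanishingIdeal P) v) (ha0 : a (Fin.last n) = 0)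
    (hb : b ∈ footprintDeg (vanishingIdeal P) v) (hb0 : b (Fin.last n) = 0) : a = b := by
  classical
  by_contra hab
  choose f hf using exists_isIndicator_vNumber hinj hlast
  -- Forms of degree `v + 1` lie in `(I, t)`, so monomials of degree `v` are socle elements.
  have hsoc : ∀ c : Fin (n + 1) →₀ ℕ, c.degree = v → ∀ j,
      X j * monomial c (1 : K) ∈ sectionIdeal P := fun c hc j =>
    mem_sectionIdeal_of_isHomogeneous hlast hf (d := 1 + v) (fun i => by rw [hv]; omega)
      ((isHomogeneous_X _ _).mul (isHomogeneous_monomial _ hc))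
  obtain ⟨x, y, hxy, h⟩ := exists_smul_add_smul_mem hinj hlast hG (hsoc a ha.2) (hsoc b hb.2)
  have h0 := eq_zero_of_mem_sectionIdeal hlast h
    (add_mem (Submodule.smul_mem _ _ ((monomial_mem_restrictSupport K).2 (Or.inl ha.1)))
      (Submodule.smul_mem _ _ ((monomial_mem_restrictSupport K).2 (Or.inl hb.1)))) fun c hc => by
        by_cases hca : a = c
        · exact hca ▸ ha0
        by_cases hcb : b = c
        · exact hcb ▸ hb0
        simp [mem_support_iff, coeff_monomial, hca, hcb] at hc
  have hx := congrArg (coeff a) h0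
  have hy := congrArg (coeff b) h0
  simp [coeff_monomial, hab, Ne.symm hab] at hx hy
  exact hxy.elim (· hx) (· hy)

/-- The coefficient of `t^a` in the remainder of a form of degree `e`, expressed in terms of its
values at the points. -/
lemma sum_coeff_mul_eval_eq_zero [Fintype ι] (hlast : ∀ i, P i (Fin.last n) = 1) {v : ℕ}
    (hv : ∀ i, vNumber P i = v) {f : ι → MvPolynomial (Fin (n + 1)) K}
    (hf : ∀ i, IsStandardIndicator P i (f i)) {a : Fin (n + 1) →₀ ℕ} (ha : a (Fin.last n) = 0)
    {e : ℕ} (he : e ≤ v) {h : MvPolynomial (Fin (n + 1)) K} (hh : h.IsHomogeneous e)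
    (hr : ∀ r, IsRemainder (vanishingIdeal P) h r → coeff a r = 0) :
    ∑ i, coeff a (f i) * (eval (P i) (f i))⁻¹ * eval (P i) h = 0 := by
  obtain ⟨r, hr'⟩ := exists_isRemainder (vanishingIdeal P) h
  have har := hr r hr'
  obtain ⟨hrΔ, g, hg, rfl⟩ := hr'
  have hh' : (X (Fin.last n) ^ (v - e) * (g + r)).IsHomogeneous v := by
    have := (isHomogeneous_X_pow (R := K) (Fin.last n) (v - e)).mul hh
    rwa [Nat.sub_add_cancel he] at this
  have h1 := sub_sum_indicator_mem hlast (fun i => (hf i).isIndicator) (fun i => (hv i).le) hh'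
  simp only [hv, Nat.sub_self, pow_zero, one_mul, map_mul, map_pow, eval_X, hlast, one_pow] at h1
  have h2 : X (Fin.last n) ^ (v - e) * r - ∑ i, C (eval (P i) (g + r) * (eval (P i) (f i))⁻¹) * f i
      = 0 := by
    refine eq_zero_of_mem_of_mem_restrictSupport (I := vanishingIdeal P) ?_ (sub_mem
      (X_last_pow_mul_mem_restrictSupport hlast hrΔ _) (sum_mem fun i _ => ?_))
    · have := sub_mem h1 (Ideal.mul_mem_left _ (X (Fin.last n) ^ (v - e)) hg)
      rw [mul_add, sub_right_comm, add_sub_cancel_left] at this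
      simpa using this
    · rw [← smul_eq_C_mul]
      exact Submodule.smul_mem _ _ (hf i).2.2.2
  -- The hypothesis on remainders matters only when `e = v`; otherwise `t` divides the product but
  -- not `t^a`.
  have h3 : coeff a (X (Fin.last n) ^ (v - e) * r) = 0 := by
    cases v - e with
    | zero => simpa using har
    | succ s =>
      rw [pow_succ', mul_assoc, coeff_X_mul', if_neg]
      simpa using ha
  have h4 := congrArg (coeff a) h2
  simp only [coeff_sub, h3, zero_sub, coeff_sum, coeff_C_mul, coeff_zero, neg_eq_zero] at h4
  rw [← h4]
  exact Finset.sum_congr rfl fun i _ => by ring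

end StandardIndicator

/-! ### Dimensions and orthogonality of evaluation codes -/

section Codes

variable {n m : ℕ} {K : Type*} [Field K]

lemma finrank_dualCode (C : Submodule K (Fin m → K)) :
    Module.finrank K C + Module.finrank K (dualCode C) = m := by
  have h : dualCode C =
      C.dualAnnihilator.map ((dotProductEquiv K (Fin m)).symm : Module.Dual K _ →ₗ[K] _) := by
    rw [← Submodule.comap_equiv_eq_map_symm]
    ext x
    rw [Submodule.mem_comap, Submodule.mem_dualAnnihilator]
    exact Iff.rfl
  rw [h, LinearEquiv.finrank_map_eq, Subspace.finrank_add_finrank_dualAnnihilator_eq]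
  simp

lemma finrank_map_of_injOn {V W : Type*} [AddCommGroup V] [Module K V] [AddCommGroup W]
    [Module K W] (f : V →ₗ[K] W) (p : Submodule K V) (h : ∀ x ∈ p, f x = 0 → x = 0) :
    Module.finrank K (p.map f) = Module.finrank K p := by
  rw [← LinearMap.range_domRestrict]
  refine LinearMap.finrank_range_of_inj ((injective_iff_map_eq_zero _).2 fun x hx => ?_)
  exact Subtype.ext (h x x.2 hx)

lemma finrank_scaleCode {γ : Fin m → K} (hγ : ∀ i, γ i ≠ 0) (C : Submodule K (Fin m → K)) :
    Module.finrank K (scaleCode γ C) = Module.finrank K C :=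
  finrank_map_of_injOn _ _ fun _ _ hx =>
    funext fun i => (mul_eq_zero.1 (congrFun hx i)).resolve_left (hγ i)

lemma isHomogeneous_of_mem_restrictSupport {I : Ideal (MvPolynomial (Fin n) K)} {d : ℕ}
    {Γ : Set (Fin n →₀ ℕ)} (hΓ : Γ ⊆ footprintDeg I d) {p : MvPolynomial (Fin n) K}
    (hp : p ∈ restrictSupport K Γ) : p.IsHomogeneous d := by
  rw [p.as_sum]
  exact IsHomogeneous.sum _ _ _ fun c hc => isHomogeneous_monomial _
    (hΓ ((mem_restrictSupport_iff K).1 hp hc)).2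

/-- Evaluation is injective on the span: a form vanishing at all points lies in `I`, and a standard
polynomial in `I` is zero. -/
lemma finrank_evCode {P : Fin m → Fin n → K} {d : ℕ} {Γ : Finset (Fin n →₀ ℕ)}
    (hΓ : (Γ : Set (Fin n →₀ ℕ)) ⊆ footprintDeg (vanishingIdeal P) d) :
    Module.finrank K (evCode P Γ) = Γ.card := by
  rw [evCode, finrank_map_of_injOn]
  · rw [Module.finrank_eq_card_basis (basisRestrictSupport K (Γ : Set (Fin n →₀ ℕ)))]
    simp
  · intro p hp h0
    refine eq_zero_of_mem_of_mem_restrictSupport (I := vanishingIdeal P)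
      (mem_vanishingIdeal_of_isHomogeneous (isHomogeneous_of_mem_restrictSupport hΓ hp) fun i => ?_)
      (restrictSupport_mono K (fun c hc => (hΓ hc).1) hp)
    have := congrFun h0 i
    simpa [ev, aeval_def] using this

/-- Orthogonality says that a linear functional kills products from the two spans, so products of
monomials suffice. -/
lemma scaleCode_le_dualCode {P : Fin m → Fin n → K} {γ : Fin m → K}
    {Γ₁ Γ₂ : Finset (Fin n →₀ ℕ)}
    (h : ∀ u₁ ∈ Γ₁, ∀ u₂ ∈ Γ₂,
      ∑ i, γ i * eval (P i) (monomial u₁ 1 * monomial u₂ 1) = 0) :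
    scaleCode γ (evCode P Γ₁) ≤ dualCode (evCode P Γ₂) := by
  let φ : MvPolynomial (Fin n) K →ₗ[K] K := ∑ i, γ i • (aeval (P i)).toLinearMap
  have hφ : ∀ p, φ p = ∑ i, γ i * eval (P i) p := fun p => by
    simp [φ]
  have hle : restrictSupport K (Γ₁ : Set (Fin n →₀ ℕ)) * restrictSupport K (Γ₂ : Set (Fin n →₀ ℕ))
      ≤ LinearMap.ker φ := by
    rw [restrictSupport_eq_span, restrictSupport_eq_span, Submodule.span_mul_span,
      Submodule.span_le]
    rintro _ ⟨_, ⟨u₁, h₁, rfl⟩, _, ⟨u₂, h₂, rfl⟩, rfl⟩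
    exact (hφ _).trans (h u₁ h₁ u₂ h₂)
  rintro _ ⟨_, ⟨p, hp, rfl⟩, rfl⟩ _ ⟨q, hq, rfl⟩
  have := hle (Submodule.mul_mem_mul hp hq)
  rw [LinearMap.mem_ker, hφ] at this
  rw [← this]
  exact Finset.sum_congr rfl fun i _ => by simp [ev, aeval_def, mul_assoc]

end Codes

end ProjEval

theorem mainTheorem11 {K : Type*} [Field K] [Finite K] (n m : ℕ) (hm : 2 ≤ m)
    (P : Fin m → Fin (n + 1) → K) (hP : ∀ i, P i ≠ 0)
    (hinj : Function.Injective fun i => Projectivization.mk K (P i) (hP i))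
    (hlast : ∀ i, P i (Fin.last n) = 1)
    (hG : ProjEval.IsGorenstein (ProjEval.vanishingIdeal P)) :
    ∃ a : Fin (n + 1) →₀ ℕ,
      (ProjEval.IsEssential P a ∧ a (Fin.last n) = 0) ∧
      (∀ b, ProjEval.IsEssential P b → b (Fin.last n) = 0 → b = a) ∧
      ∀ f : Fin m → MvPolynomial (Fin (n + 1)) K,
        (∀ i, ProjEval.IsStandardIndicator P i (f i)) →
        ∀ (d k : ℕ) (Γ₁ Γ₂ : Finset (Fin (n + 1) →₀ ℕ)),
          (Γ₁ : Set (Fin (n + 1) →₀ ℕ)) ⊆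
            ProjEval.footprintDeg (ProjEval.vanishingIdeal P) d →
          (Γ₂ : Set (Fin (n + 1) →₀ ℕ)) ⊆
            ProjEval.footprintDeg (ProjEval.vanishingIdeal P) k →
          ((d + k : ℕ) : ℤ) ≤ ProjEval.reg (ProjEval.vanishingIdeal P) →
          Γ₁.card + Γ₂.card = m →
          (∀ u₁ ∈ Γ₁, ∀ u₂ ∈ Γ₂, ∀ r,
            ProjEval.IsRemainder (ProjEval.vanishingIdeal P)
              (MvPolynomial.monomial u₁ 1 * MvPolynomial.monomial u₂ 1) r →
            MvPolynomial.coeff a r = 0) →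
          ProjEval.scaleCode
              (fun i => MvPolynomial.coeff a (f i) * (MvPolynomial.eval (P i) (f i))⁻¹)
              (ProjEval.evCode P Γ₁) =
            ProjEval.dualCode (ProjEval.evCode P Γ₂) := by
  have hinjP : Function.Injective P := fun i j hij => hinj (by
    simp only [hij])
  have : Nonempty (Fin m) := ⟨⟨0, by omega⟩⟩
  let i₀ : Fin m := ⟨0, by omega⟩
  obtain ⟨v, hv⟩ : ∃ v, ∀ i, ProjEval.vNumber P i = v :=
    ⟨_, fun i => ProjEval.vNumber_eq_vNumber hinjP hlast hG i i₀⟩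
  obtain ⟨f₀, hf₀⟩ := ProjEval.exists_isStandardIndicator hinjP hlast i₀
  obtain ⟨a, ha, ha0⟩ := hf₀.exists_mem_support hinjP hlast
  have haΔ := hf₀.mem_footprintDeg ha
  rw [hv] at haΔ
  -- Every standard indicator contains a monomial of degree `v` prime to `t`, and `t^a` is the only
  -- candidate.
  have hess : ProjEval.IsEssential P a := ⟨haΔ.1, fun i f hf => by
    obtain ⟨c, hc, hc0⟩ := hf.exists_mem_support hinjP hlast
    have hcΔ := hf.mem_footprintDeg hc
    rw [hv] at hcΔ
    rw [ProjEval.eq_of_mem_footprintDeg hinjP hlast hG hv haΔ ha0 hcΔ hc0]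
    exact mem_support_iff.1 hc⟩
  refine ⟨a, ⟨hess, ha0⟩, fun b hb hb0 => ?_, fun f hf d k Γ₁ Γ₂ h₁ h₂ hdk hcard hrem => ?_⟩
  · have hbΔ := hf₀.mem_footprintDeg (mem_support_iff.2 (hb.2 i₀ f₀ hf₀))
    rw [hv] at hbΔ
    exact ProjEval.eq_of_mem_footprintDeg hinjP hlast hG hv hbΔ hb0 haΔ ha0
  have hdk : d + k ≤ v := by
    exact_mod_cast hdk.trans (ProjEval.reg_le hinjP hlast hv)
  -- Essentiality of `t^a` makes every entry of `γ` nonzero, so scaling preserves dimension and both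
  -- codes have dimension `Γ₁.card = m - Γ₂.card`.
  refine Submodule.eq_of_le_of_finrank_eq
    (ProjEval.scaleCode_le_dualCode fun u₁ hu₁ u₂ hu₂ => ?_) ?_
  · exact ProjEval.sum_coeff_mul_eval_eq_zero hlast hv hf ha0 hdk
      ((isHomogeneous_monomial _ (h₁ hu₁).2).mul (isHomogeneous_monomial _ (h₂ hu₂).2))
      (hrem u₁ hu₁ u₂ hu₂)
  · rw [ProjEval.finrank_scaleCode fun i => mul_ne_zero (hess.2 i _ (hf i))
      (inv_ne_zero (hf i).2.1), ProjEval.finrank_evCode h₁]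
    have := ProjEval.finrank_dualCode (ProjEval.evCode P Γ₂)
    rw [ProjEval.finrank_evCode h₂] at this
    omega
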